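/- Let $\overline M$ be a complex manifold of complex dimension $2n+1$ with complex structure $J$, carrying a complex contact structure (an open covering with holomorphic 1-forms $\theta_i$ such that $\theta_i\wedge(d\theta_i)^n$ vanishes nowhere and $\theta_i=f_{ij}\theta_j$ with nowhere vanishing holomorphic $f_{ij}$ on overlaps). Let $(u,v,U,V,G,H,\overline g)$ be an indefinite complex contact metric structure on it: $\overline g$ is a Hermitian semi-Riemannian metric of index $4q$ with $0<q<n$, and on the members of an open covering there are 1-forms $u$, $v=u\circ J$, vector fields $U$, $V=-JU$ and (1,1)-tensors $G$, $H=GJ$ with $$G^2=H^2=-I+u\otimes U+v\otimes V,\quad GJ=-JG,\quad GU=0,\quad u(U)=1,$$ $$\overline g(GX,Y)=-\overline g(X,GY),\quad \overline g(U,X)=u(X),$$ which on overlaps transform by $u'=au-bv$, $v'=bu+av$, $G'=aG-bH$, $H'=bG+aH$ with $a^2+b^2=1$; $u-\sqrt{-1}\,v$ is a nonvanishing multiple of the contact form; and, for a local 1-form $\sigma$, $$du(X,Y)=\overline g(X,GY)+(\sigma\wedge v)(X,Y),\qquad dv(X,Y)=\overline g(X,HY)-(\sigma\wedge u)(X,Y).$$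 Here $2\,d\alpha(X,Y)=X\alpha(Y)-Y\alpha(X)-\alpha([X,Y])$ and $2(\alpha\wedge\beta)(X,Y)=\alpha(X)\beta(Y)-\alpha(Y)\beta(X)$. Put $\mathcal V=\mathrm{Span}\{U,V\}$ and $\mathcal H=\ker u\cap\ker v$. Suppose that the structure is normal, i.e. $S(X,Y)=T(X,Y)=0$ for $X,Y\in\Gamma(\mathcal H)$ and $S(U,X)=T(V,X)=0$ for all $X$, where, with $[G,G]$ and $[H,H]$ the Nijenhuis tensors (so $[G,G](X,Y)=G^2[X,Y]+[GX,GY]-G[GX,Y]-G[X,GY]$), $$\begin{aligned}S(X,Y)={}&[G,G](X,Y)+2\overline g(X,GY)U-2\overline g(X,HY)V+2\{v(Y)HX-v(X)HY\}\\&+\sigma(GY)HX-\sigma(GX)HY+\sigma(X)GHY-\sigma(Y)GHX,\\ T(X,Y)={}&[H,H](X,Y)-2\overline g(X,GY)U+2\overline g(X,HY)V+2\{u(Y)GX-u(X)GY\}\\&+\sigma(HX)GY-\sigma(HY)GX+\sigma(X)GHY-\sigma(Y)GHX.\end{aligned}$$ Let $M\neq\emptyset$ be an immersed null hypersurface of $\overline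 M$ (real dimension $4n+1$, the induced tensor has constant rank $4n$, and $TM^\perp$ is a rank one distribution on $M$), tangent to $\mathcal V$. Let $S(TM)$ be a screen distribution, that is, a smooth distribution complementary to $TM^\perp$ in $TM$, and let $\mathrm{tr}(TM)$ be the corresponding null transversal bundle: the line bundle along $M$ spanned by the vectors $N$ with $\overline g(N,\xi)=1$ for some $\xi\in TM^\perp$, $\overline g(N,N)=0$ and $\overline g(N,Z)=0$ for all $Z\in S(TM)$. For a vector field $N$ along $M$ say that $\pounds_N\overline g=0$ along $M$ if $(\pounds_N\overline g)(X,Y)=0$ for all $X,Y$ tangent to $M$ (for such $X,Y$ the value depends only on $N$ along $M$). Then: 1. $\mathrm{tr}(TM)$ is not a Killing distribution, i.e. it is not true that $\pounds_N\overline g=0$ along $M$ for every $N\in\Gamma(\mathrm{tr}(TM))$. 2. If $S(TM)$ contains $J(TM^\perp)$, $G(TM^\perp)$, $H(TM^\perp)$ and $\mathcal V$ (which the usual choice of screen for such hypersurfaces does), then moreover no nowhere vanishing smooth section $N$ of $\mathrm{tr}(TM)$ over a nonempty open subset $W\subseteq M$ satisfies $\pounds_N\overline g=0$ along $W$. -/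

import Mathlib

open scoped Manifold ContDiff Bundle Topology

noncomputable section

/-! ### Vector fields, one-forms and tensor fields on a manifold without boundary -/

section Tensors

variable {𝕜 : Type*} [NontriviallyNormedField 𝕜]
  {E : Type*} [NormedAddCommGroup E] [NormedSpace 𝕜 E]
  {M : Type*} [TopologicalSpace M] [ChartedSpace E M]

/-- `X` is a vector field of class `C^r` on the set `A`. -/
def IsVectorFieldOn [IsManifold 𝓘(𝕜, E) 1 M] (r : ℕ∞ω)
    (X : (x : M) → TangentSpace 𝓘(𝕜, E) x) (A : Set M) : Prop :=
  ContMDiffOn 𝓘(𝕜, E) 𝓘(𝕜, E).tangent r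
    (fun x => (Bundle.TotalSpace.mk' E x (X x) : TangentBundle 𝓘(𝕜, E) M)) A

/-- `α` is a one-form of class `C^r` on the set `A`. -/
def IsOneFormOn [IsManifold 𝓘(𝕜, E) 1 M] (r : ℕ∞ω)
    (α : (x : M) → TangentSpace 𝓘(𝕜, E) x →L[𝕜] 𝕜) (A : Set M) : Prop :=
  ContMDiffOn 𝓘(𝕜, E) (𝓘(𝕜, E).prod 𝓘(𝕜, E →L[𝕜] 𝕜)) r
    (fun x => Bundle.TotalSpace.mk' (E →L[𝕜] 𝕜)
      (E := fun x : M => TangentSpace 𝓘(𝕜, E) x →L[𝕜] 𝕜) x (α x)) A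

/-- `A` is a (1,1)-tensor field of class `C^r` on the set `D`. -/
def IsEndomorphismFieldOn [IsManifold 𝓘(𝕜, E) 1 M] (r : ℕ∞ω)
    (A : (x : M) → TangentSpace 𝓘(𝕜, E) x →L[𝕜] TangentSpace 𝓘(𝕜, E) x) (D : Set M) : Prop :=
  ContMDiffOn 𝓘(𝕜, E) (𝓘(𝕜, E).prod 𝓘(𝕜, E →L[𝕜] E)) r
    (fun x => Bundle.TotalSpace.mk' (E →L[𝕜] E)
      (E := fun x : M => TangentSpace 𝓘(𝕜, E) x →L[𝕜] TangentSpace 𝓘(𝕜, E) x) x (A x)) D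

/-- The derivative at `x` of the scalar function `f` in the direction of the tangent vector `w`. -/
def dirDeriv (f : M → 𝕜) (x : M) (w : TangentSpace 𝓘(𝕜, E) x) : 𝕜 :=
  (mfderiv 𝓘(𝕜, E) 𝓘(𝕜, 𝕜) f x w : 𝕜)

/-- The value at `x` of `dα(X, Y)`, with the normalisation
`2 dα(X, Y) = X (α Y) - Y (α X) - α [X, Y]` customary in contact metric geometry. -/
def extDer (α : (x : M) → TangentSpace 𝓘(𝕜, E) x →L[𝕜] 𝕜)
    (X Y : (x : M) → TangentSpace 𝓘(𝕜, E) x) (x : M) : 𝕜 :=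
  (1 / 2) * (dirDeriv (fun y => α y (Y y)) x (X x) - dirDeriv (fun y => α y (X y)) x (Y x)
    - α x (VectorField.mlieBracket 𝓘(𝕜, E) X Y x))

/-- The value at `x` of `(α ∧ β)(X, Y)`, in the normalisation that goes with `extDer`. -/
def wedge (α β : (x : M) → TangentSpace 𝓘(𝕜, E) x →L[𝕜] 𝕜) (x : M)
    (a b : TangentSpace 𝓘(𝕜, E) x) : 𝕜 :=
  (1 / 2) * (α x a * β x b - α x b * β x a)

/-- The value at `x` of the Nijenhuis tensor `[A, A](X, Y)`. -/
def nijenhuis (A : (x : M) → TangentSpace 𝓘(𝕜, E) x →L[𝕜] TangentSpace 𝓘(𝕜, E) x)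
    (X Y : (x : M) → TangentSpace 𝓘(𝕜, E) x) (x : M) : TangentSpace 𝓘(𝕜, E) x :=
  A x (A x (VectorField.mlieBracket 𝓘(𝕜, E) X Y x))
    + VectorField.mlieBracket 𝓘(𝕜, E) (fun y => A y (X y)) (fun y => A y (Y y)) x
    - A x (VectorField.mlieBracket 𝓘(𝕜, E) (fun y => A y (X y)) Y x)
    - A x (VectorField.mlieBracket 𝓘(𝕜, E) X (fun y => A y (Y y)) x)

/-- `x ↦ S x` is a distribution of rank `r`: it is locally spanned by `r` smooth vector fields
that are linearly independent at every point. -/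
def IsSmoothDistribution [IsManifold 𝓘(𝕜, E) 1 M] (r : ℕ)
    (S : (x : M) → Submodule 𝕜 (TangentSpace 𝓘(𝕜, E) x)) : Prop :=
  ∀ x₀ : M, ∃ A : Set M, IsOpen A ∧ x₀ ∈ A ∧
    ∃ Z : Fin r → (x : M) → TangentSpace 𝓘(𝕜, E) x,
      (∀ k, IsVectorFieldOn ∞ (Z k) A) ∧
      ∀ x ∈ A, LinearIndependent 𝕜 (fun k => Z k x) ∧
        S x = Submodule.span 𝕜 (Set.range fun k => Z k x)

end Tensors

/-! ### Semi-Riemannian metrics -/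

section Metric

/-- A smooth semi-Riemannian metric. -/
structure SemiRiemannianMetric (E : Type*) [NormedAddCommGroup E] [NormedSpace ℝ E]
    (M : Type*) [TopologicalSpace M] [ChartedSpace E M] [IsManifold 𝓘(ℝ, E) ∞ M] where
  val : (x : M) → TangentSpace 𝓘(ℝ, E) x →L[ℝ] TangentSpace 𝓘(ℝ, E) x →L[ℝ] ℝ
  symm : ∀ x a b, val x a b = val x b a
  nondegenerate : ∀ x a, (∀ b, val x a b = 0) → a = 0
  smooth : ContMDiff 𝓘(ℝ, E) (𝓘(ℝ, E).prod 𝓘(ℝ, E →L[ℝ] E →L[ℝ] ℝ)) ∞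
    (fun x => Bundle.TotalSpace.mk' (E →L[ℝ] E →L[ℝ] ℝ)
      (E := fun x : M => TangentSpace 𝓘(ℝ, E) x →L[ℝ] TangentSpace 𝓘(ℝ, E) x →L[ℝ] ℝ) x (val x))

variable {E : Type*} [NormedAddCommGroup E] [NormedSpace ℝ E]
  {M : Type*} [TopologicalSpace M] [ChartedSpace E M] [IsManifold 𝓘(ℝ, E) ∞ M]

/-- The metric has constant index `k`: at every point, `k` is the largest dimension of a subspace
of the tangent space on which the metric is negative definite. -/
def SemiRiemannianMetric.HasIndex (g : SemiRiemannianMetric E M) (k : ℕ) : Prop :=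
  ∀ x : M, IsGreatest {d : ℕ | ∃ W : Submodule ℝ (TangentSpace 𝓘(ℝ, E) x),
    Module.finrank ℝ W = d ∧ ∀ a ∈ W, a ≠ 0 → g.val x a a < 0} k

/-- The Lie derivative of the metric: the value at `x` of `(£_N g)(X, Y)`. -/
def SemiRiemannianMetric.lieDeriv (g : SemiRiemannianMetric E M)
    (N X Y : (x : M) → TangentSpace 𝓘(ℝ, E) x) (x : M) : ℝ :=
  dirDeriv (fun y => g.val y (X y) (Y y)) x (N x)
    - g.val x (VectorField.mlieBracket 𝓘(ℝ, E) N X x) (Y x)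
    - g.val x (X x) (VectorField.mlieBracket 𝓘(ℝ, E) N Y x)

end Metric

/-! ### Complex manifolds -/

section Complex

variable {E : Type*} [NormedAddCommGroup E] [NormedSpace ℂ E]
  {M : Type*} [TopologicalSpace M] [ChartedSpace E M]

/-- A complex manifold is in particular a real (analytic) manifold. -/
instance complexManifoldIsRealManifold [h : IsManifold 𝓘(ℂ, E) ω M] : IsManifold 𝓘(ℝ, E) ω M := by
  apply isManifold_of_contDiffOn
  intro e e' he he'
  have h1 := (contDiffGroupoid ω 𝓘(ℂ, E)).compatible he he'
  rw [contDiffGroupoid, mem_groupoid_of_pregroupoid] at h1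
  have h4 := h1.1
  simp only [contDiffPregroupoid] at h4
  exact ContDiffOn.restrict_scalars ℝ h4

/-- The complex structure of the real tangent spaces of a complex manifold: multiplication by the
imaginary unit in the preferred chart. -/
def cpxJ (x : M) : TangentSpace 𝓘(ℝ, E) x →L[ℝ] TangentSpace 𝓘(ℝ, E) x :=
  ((Complex.I • ContinuousLinearMap.id ℂ E).restrictScalars ℝ : E →L[ℝ] E)

/-- The identification of the real tangent spaces of a complex manifold with the holomorphic
ones. -/
def toHolTangent (x : M) (a : TangentSpace 𝓘(ℝ, E) x) : TangentSpace 𝓘(ℂ, E) x :=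
  (a : E)

/-- The value at `x` of `(θ ∧ (dθ)^n)(X 0, …, X (2n))`, up to a nonzero numerical factor. -/
def contactVolume (n : ℕ) (θ : (x : M) → TangentSpace 𝓘(ℂ, E) x →L[ℂ] ℂ)
    (X : Fin (2 * n + 1) → (x : M) → TangentSpace 𝓘(ℂ, E) x) (x : M) : ℂ :=
  ∑ p : Equiv.Perm (Fin (2 * n + 1)), ((Equiv.Perm.sign p : ℤ) : ℂ) *
    (θ x (X (p 0) x) * ∏ k : Fin n,
      extDer θ (X (p ⟨2 * k.val + 1, by omega⟩)) (X (p ⟨2 * k.val + 2, by omega⟩)) x)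

/-- A complex contact structure on a complex manifold of complex dimension `2n + 1`: an open
covering with holomorphic one-forms `θ i` such that `θ i ∧ (dθ i)^n` vanishes nowhere, and
`θ i = f θ j` with a nowhere vanishing holomorphic function `f` on each overlap. -/
structure ComplexContactStructure.{w, u, v} (n : ℕ)
    (E : Type u) [NormedAddCommGroup E] [NormedSpace ℂ E]
    (M : Type v) [TopologicalSpace M] [ChartedSpace E M] [IsManifold 𝓘(ℂ, E) ω M] where
  ι : Type w
  dom : ι → Set M
  isOpen_dom : ∀ i, IsOpen (dom i)
  cover : ∀ x, ∃ i, x ∈ dom i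
  θ : ι → (x : M) → TangentSpace 𝓘(ℂ, E) x →L[ℂ] ℂ
  holomorphic : ∀ i, IsOneFormOn ω (θ i) (dom i)
  contact : ∀ i, ∀ x ∈ dom i, ∃ (A : Set M)
    (X : Fin (2 * n + 1) → (x : M) → TangentSpace 𝓘(ℂ, E) x),
    IsOpen A ∧ x ∈ A ∧ (∀ k, IsVectorFieldOn ω (X k) A) ∧ contactVolume n (θ i) X x ≠ 0
  transition : ∀ i j, ∃ f : M → ℂ, ContMDiffOn 𝓘(ℂ, E) 𝓘(ℂ, ℂ) ω f (dom i ∩ dom j) ∧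
    ∀ x ∈ dom i ∩ dom j, f x ≠ 0 ∧ θ i x = f x • θ j x

/-- A complex almost contact metric structure `(u, v, U, V, G, H, g)`, where `v = u ∘ J`,
`V = -J U` and `H = G J` are determined by `u`, `U`, `G` (see `v`, `V`, `H` below). -/
structure ComplexAlmostContactMetricStructure.{w, u, v}
    (E : Type u) [NormedAddCommGroup E] [NormedSpace ℂ E]
    (M : Type v) [TopologicalSpace M] [ChartedSpace E M] [IsManifold 𝓘(ℂ, E) ω M] where
  /-- the Hermitian semi-Riemannian metric -/
  g : SemiRiemannianMetric E M
  hermitian : ∀ x a b, g.val x (cpxJ x a) (cpxJ x b) = g.val x a b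
  ι : Type w
  dom : ι → Set M
  isOpen_dom : ∀ i, IsOpen (dom i)
  cover : ∀ x, ∃ i, x ∈ dom i
  u : ι → (x : M) → TangentSpace 𝓘(ℝ, E) x →L[ℝ] ℝ
  U : ι → (x : M) → TangentSpace 𝓘(ℝ, E) x
  G : ι → (x : M) → TangentSpace 𝓘(ℝ, E) x →L[ℝ] TangentSpace 𝓘(ℝ, E) x
  smooth_u : ∀ i, IsOneFormOn ∞ (u i) (dom i)
  smooth_U : ∀ i, IsVectorFieldOn ∞ (U i) (dom i)
  smooth_G : ∀ i, IsEndomorphismFieldOn ∞ (G i) (dom i)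
  u_U : ∀ i, ∀ x ∈ dom i, u i x (U i x) = 1
  g_U : ∀ i, ∀ x ∈ dom i, ∀ a, g.val x (U i x) a = u i x a
  G_U : ∀ i, ∀ x ∈ dom i, G i x (U i x) = 0
  G_J : ∀ i, ∀ x ∈ dom i, ∀ a, G i x (cpxJ x a) = -cpxJ x (G i x a)
  G_skew : ∀ i, ∀ x ∈ dom i, ∀ a b, g.val x (G i x a) b = -g.val x a (G i x b)
  G_sq : ∀ i, ∀ x ∈ dom i, ∀ a, G i x (G i x a) =
    -a + u i x a • U i x + u i x (cpxJ x a) • (-cpxJ x (U i x))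
  H_sq : ∀ i, ∀ x ∈ dom i, ∀ a, G i x (cpxJ x (G i x (cpxJ x a))) =
    -a + u i x a • U i x + u i x (cpxJ x a) • (-cpxJ x (U i x))
  transition : ∀ i j, ∃ α β : M → ℝ, ∀ x ∈ dom i ∩ dom j, α x ^ 2 + β x ^ 2 = 1 ∧
    ∀ a : TangentSpace 𝓘(ℝ, E) x,
      u j x a = α x * u i x a - β x * u i x (cpxJ x a) ∧
      u j x (cpxJ x a) = β x * u i x a + α x * u i x (cpxJ x a) ∧
      G j x a = α x • G i x a - β x • G i x (cpxJ x a) ∧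
      G j x (cpxJ x a) = β x • G i x a + α x • G i x (cpxJ x a)

namespace ComplexAlmostContactMetricStructure

variable [IsManifold 𝓘(ℂ, E) ω M] (Q : ComplexAlmostContactMetricStructure E M)

/-- `v = u ∘ J` -/
def v (i : Q.ι) (x : M) : TangentSpace 𝓘(ℝ, E) x →L[ℝ] ℝ := (Q.u i x).comp (cpxJ x)

/-- `V = -J U` -/
def V (i : Q.ι) (x : M) : TangentSpace 𝓘(ℝ, E) x := -cpxJ x (Q.U i x)

/-- `H = G J` -/
def H (i : Q.ι) (x : M) : TangentSpace 𝓘(ℝ, E) x →L[ℝ] TangentSpace 𝓘(ℝ, E) x :=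
  (Q.G i x).comp (cpxJ x)

end ComplexAlmostContactMetricStructure

/-- A complex contact metric structure on a complex manifold of complex dimension `2n + 1`: a
complex contact structure together with a complex almost contact metric structure such that
`u - √-1 v` is a nonvanishing multiple of the contact form, and
`du(X, Y) = g(X, GY) + (σ ∧ v)(X, Y)`, `dv(X, Y) = g(X, HY) - (σ ∧ u)(X, Y)` for a one-form `σ`. -/
structure ComplexContactMetricStructure.{w, w', u, v} (n : ℕ)
    (E : Type u) [NormedAddCommGroup E] [NormedSpace ℂ E]
    (M : Type v) [TopologicalSpace M] [ChartedSpace E M] [IsManifold 𝓘(ℂ, E) ω M]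
    extends ComplexAlmostContactMetricStructure.{w, u, v} E M where
  contactStructure : ComplexContactStructure.{w', u, v} n E M
  compatible : ∀ i j, ∀ x ∈ dom i ∩ contactStructure.dom j, ∃ c : ℂ, c ≠ 0 ∧ ∀ a,
    ((u i x a : ℂ) - Complex.I * (u i x (cpxJ x a) : ℂ)) =
      c * contactStructure.θ j x (toHolTangent x a)
  σ : ι → (x : M) → TangentSpace 𝓘(ℝ, E) x →L[ℝ] ℝ
  smooth_σ : ∀ i, IsOneFormOn ∞ (σ i) (dom i)
  du_eq : ∀ i (A : Set M) (X Y : (x : M) → TangentSpace 𝓘(ℝ, E) x),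
    IsOpen A → A ⊆ dom i → IsVectorFieldOn ∞ X A → IsVectorFieldOn ∞ Y A → ∀ x ∈ A,
      extDer (u i) X Y x = g.val x (X x) (G i x (Y x))
        + wedge (σ i) (toComplexAlmostContactMetricStructure.v i) x (X x) (Y x)
  dv_eq : ∀ i (A : Set M) (X Y : (x : M) → TangentSpace 𝓘(ℝ, E) x),
    IsOpen A → A ⊆ dom i → IsVectorFieldOn ∞ X A → IsVectorFieldOn ∞ Y A → ∀ x ∈ A,
      extDer (toComplexAlmostContactMetricStructure.v i) X Y x =
        g.val x (X x) (toComplexAlmostContactMetricStructure.H i x (Y x))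
        - wedge (σ i) (u i) x (X x) (Y x)

namespace ComplexContactMetricStructure

variable [IsManifold 𝓘(ℂ, E) ω M] {n : ℕ} (Q : ComplexContactMetricStructure n E M)

/-- The tensor `S` at `x`, evaluated on vector fields. -/
def tensorS (i : Q.ι) (X Y : (x : M) → TangentSpace 𝓘(ℝ, E) x) (x : M) : TangentSpace 𝓘(ℝ, E) x :=
  nijenhuis (Q.G i) X Y x
    + (2 * Q.g.val x (X x) (Q.G i x (Y x))) • Q.U i x
    - (2 * Q.g.val x (X x) (Q.H i x (Y x))) • Q.V i x
    + (2 : ℝ) • (Q.v i x (Y x) • Q.H i x (X x) - Q.v i x (X x) • Q.H i x (Y x))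
    + Q.σ i x (Q.G i x (Y x)) • Q.H i x (X x)
    - Q.σ i x (Q.G i x (X x)) • Q.H i x (Y x)
    + Q.σ i x (X x) • Q.G i x (Q.H i x (Y x))
    - Q.σ i x (Y x) • Q.G i x (Q.H i x (X x))

/-- The tensor `T` at `x`, evaluated on vector fields. -/
def tensorT (i : Q.ι) (X Y : (x : M) → TangentSpace 𝓘(ℝ, E) x) (x : M) : TangentSpace 𝓘(ℝ, E) x :=
  nijenhuis (Q.H i) X Y x
    - (2 * Q.g.val x (X x) (Q.G i x (Y x))) • Q.U i x
    + (2 * Q.g.val x (X x) (Q.H i x (Y x))) • Q.V i x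
    + (2 : ℝ) • (Q.u i x (Y x) • Q.G i x (X x) - Q.u i x (X x) • Q.G i x (Y x))
    + Q.σ i x (Q.H i x (X x)) • Q.G i x (Y x)
    - Q.σ i x (Q.H i x (Y x)) • Q.G i x (X x)
    + Q.σ i x (X x) • Q.G i x (Q.H i x (Y x))
    - Q.σ i x (Y x) • Q.G i x (Q.H i x (X x))

/-- `X` is a section of the horizontal subbundle `ker u ∩ ker v` over `A`. -/
def IsHorizontalOn (i : Q.ι) (X : (x : M) → TangentSpace 𝓘(ℝ, E) x) (A : Set M) : Prop :=
  ∀ x ∈ A, Q.u i x (X x) = 0 ∧ Q.v i x (X x) = 0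

/-- Normality: `S` and `T` vanish on horizontal vector fields, and `S(U, X) = T(V, X) = 0` for all
vector fields `X`. -/
def IsNormal : Prop :=
  ∀ i (A : Set M), IsOpen A → A ⊆ Q.dom i →
    (∀ X Y : (x : M) → TangentSpace 𝓘(ℝ, E) x, IsVectorFieldOn ∞ X A → IsVectorFieldOn ∞ Y A →
      Q.IsHorizontalOn i X A → Q.IsHorizontalOn i Y A →
      ∀ x ∈ A, Q.tensorS i X Y x = 0 ∧ Q.tensorT i X Y x = 0) ∧
    (∀ X : (x : M) → TangentSpace 𝓘(ℝ, E) x, IsVectorFieldOn ∞ X A →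
      ∀ x ∈ A, Q.tensorS i (Q.U i) X x = 0 ∧ Q.tensorT i (Q.V i) X x = 0)

end ComplexContactMetricStructure

end Complex

/-! ### Null hypersurfaces -/

section NullHypersurface

variable {E : Type*} [NormedAddCommGroup E] [NormedSpace ℝ E]
  {Mb : Type*} [TopologicalSpace Mb] [ChartedSpace E Mb] [IsManifold 𝓘(ℝ, E) ∞ Mb]
  {F : Type*} [NormedAddCommGroup F] [NormedSpace ℝ F]
  {M : Type*} [TopologicalSpace M] [ChartedSpace F M] [IsManifold 𝓘(ℝ, F) ∞ M]

/-- The tangent space `T_x M` of an immersed manifold, as a subspace of `T_{f x} Mb`. -/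
def tangentImage (f : M → Mb) (x : M) : Submodule ℝ (TangentSpace 𝓘(ℝ, E) (f x)) :=
  LinearMap.range (mfderiv 𝓘(ℝ, F) 𝓘(ℝ, E) f x).toLinearMap

/-- The normal space `T_x M^⊥`, a subspace of `T_{f x} Mb`. -/
def normalSpace (F : Type*) [NormedAddCommGroup F] [NormedSpace ℝ F]
    {M : Type*} [TopologicalSpace M] [ChartedSpace F M]
    (g : SemiRiemannianMetric E Mb) (f : M → Mb) (x : M) :
    Submodule ℝ (TangentSpace 𝓘(ℝ, E) (f x)) where
  carrier := {a | ∀ b : TangentSpace 𝓘(ℝ, F) x,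
    g.val (f x) a (mfderiv 𝓘(ℝ, F) 𝓘(ℝ, E) f x b) = 0}
  zero_mem' := by intro b; simp
  add_mem' := by
    intro a a' ha ha' b
    simp only [map_add, add_apply, ha b, ha' b, add_zero]
  smul_mem' := by
    intro c a ha b
    simp only [map_smul, smul_apply, ha b, smul_zero]

/-- The vectors of `T_x M` that are normal to `M`, i.e. `T_x M^⊥ ∩ T_x M` seen inside `T_x M`. -/
def radical (g : SemiRiemannianMetric E Mb) (f : M → Mb) (x : M) :
    Submodule ℝ (TangentSpace 𝓘(ℝ, F) x) :=
  (normalSpace F g f x).comap (mfderiv 𝓘(ℝ, F) 𝓘(ℝ, E) f x).toLinearMap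

/-- The induced tensor `f^* g` on `T_x M`, as a map from `T_x M` to its dual. -/
def inducedForm (g : SemiRiemannianMetric E Mb) (f : M → Mb) (x : M) :
    TangentSpace 𝓘(ℝ, F) x →ₗ[ℝ] Module.Dual ℝ (TangentSpace 𝓘(ℝ, F) x) where
  toFun a := ((g.val (f x) (mfderiv 𝓘(ℝ, F) 𝓘(ℝ, E) f x a)).toLinearMap).comp
    (mfderiv 𝓘(ℝ, F) 𝓘(ℝ, E) f x).toLinearMap
  map_add' a b := by ext c; simp
  map_smul' r a := by ext c; simp

/-- `f : M → Mb` is a null hypersurface of rank `m`: a smooth immersion of an `(m+1)`-dimensional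
manifold into an `(m+2)`-dimensional one whose induced tensor has constant rank `m`, and whose
normal bundle is tangent to `M` and is a distribution of rank one on `M`. -/
structure IsNullHypersurface (g : SemiRiemannianMetric E Mb) (f : M → Mb) (m : ℕ) : Prop where
  dim_ambient : Module.finrank ℝ E = m + 2
  dim_hypersurface : Module.finrank ℝ F = m + 1
  immersion : Manifold.IsImmersion 𝓘(ℝ, F) 𝓘(ℝ, E) ∞ f
  rank : ∀ x, Module.finrank ℝ (LinearMap.range (inducedForm (F := F) g f x)) = m
  normal_le : ∀ x, normalSpace F g f x ≤ tangentImage (F := F) f x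
  normal_distribution : IsSmoothDistribution 1 (radical (F := F) g f)

/-- A screen distribution `S(TM)`: a smooth distribution complementary to `TM^⊥` in `TM`. -/
def IsScreenDistribution (g : SemiRiemannianMetric E Mb) (f : M → Mb) (m : ℕ)
    (S : (x : M) → Submodule ℝ (TangentSpace 𝓘(ℝ, F) x)) : Prop :=
  IsSmoothDistribution m S ∧ ∀ x, IsCompl (S x) (radical g f x)

/-- The fibre at `x` of the null transversal bundle `tr(TM)` with respect to the screen
distribution `S`: the span of the vectors `N` with `g(N, ξ) = 1` for some `ξ ∈ T_x M^⊥`,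
`g(N, N) = 0`, and `g(N, Z) = 0` for all `Z ∈ S x`. -/
def transversalSpace (g : SemiRiemannianMetric E Mb) (f : M → Mb)
    (S : (x : M) → Submodule ℝ (TangentSpace 𝓘(ℝ, F) x)) (x : M) :
    Submodule ℝ (TangentSpace 𝓘(ℝ, E) (f x)) :=
  Submodule.span ℝ {N | (∃ ξ ∈ normalSpace F g f x, g.val (f x) ξ N = 1) ∧ g.val (f x) N N = 0 ∧
    ∀ Z ∈ S x, g.val (f x) N (mfderiv 𝓘(ℝ, F) 𝓘(ℝ, E) f x Z) = 0}

/-- `N` is a smooth section over `W` of the null transversal bundle. -/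
def IsTransversalSectionOn (g : SemiRiemannianMetric E Mb) (f : M → Mb)
    (S : (x : M) → Submodule ℝ (TangentSpace 𝓘(ℝ, F) x))
    (N : (x : M) → TangentSpace 𝓘(ℝ, E) (f x)) (W : Set M) : Prop :=
  ContMDiffOn 𝓘(ℝ, F) 𝓘(ℝ, E).tangent ∞
    (fun x => (Bundle.TotalSpace.mk' E (f x) (N x) : TangentBundle 𝓘(ℝ, E) Mb)) W ∧
  ∀ x ∈ W, N x ∈ transversalSpace g f S x

/-- The vector field `N` along `f` is Killing at `x`, i.e. `(£_N g)(a, b) = 0` for all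
`a, b ∈ T_x M`. The Lie derivative is computed with local extensions of `N`, `a`, `b` to vector
fields of the ambient manifold; on vectors tangent to `M` its value does not depend on them. -/
def IsKillingAlongAt (g : SemiRiemannianMetric E Mb) (f : M → Mb)
    (N : (x : M) → TangentSpace 𝓘(ℝ, E) (f x)) (x : M) : Prop :=
  ∀ (A : Set Mb) (N' X Y : (y : Mb) → TangentSpace 𝓘(ℝ, E) y), IsOpen A → f x ∈ A →
    IsVectorFieldOn ∞ N' A → IsVectorFieldOn ∞ X A → IsVectorFieldOn ∞ Y A →
    (∀ᶠ y in 𝓝 x, N' (f y) = N y) →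
    X (f x) ∈ tangentImage (F := F) f x → Y (f x) ∈ tangentImage (F := F) f x →
    g.lieDeriv N' X Y (f x) = 0

/-- The null transversal bundle is a Killing distribution: `£_N g = 0` along `M` for every smooth
section `N` of it. -/
def IsKillingTransversal (g : SemiRiemannianMetric E Mb) (f : M → Mb)
    (S : (x : M) → Submodule ℝ (TangentSpace 𝓘(ℝ, F) x)) : Prop :=
  ∀ N : (x : M) → TangentSpace 𝓘(ℝ, E) (f x), IsTransversalSectionOn g f S N Set.univ →
    ∀ x, IsKillingAlongAt (F := F) g f N x

end NullHypersurface

section Contact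

variable {E : Type*} [NormedAddCommGroup E] [NormedSpace ℂ E]
  {Mb : Type*} [TopologicalSpace Mb] [ChartedSpace E Mb] [IsManifold 𝓘(ℂ, E) ω Mb]
  {F : Type*} [NormedAddCommGroup F] [NormedSpace ℝ F]
  {M : Type*} [TopologicalSpace M] [ChartedSpace F M] [IsManifold 𝓘(ℝ, F) ∞ M]

/-- `M` is tangent to the vertical subbundle `Span {U, V}`. -/
def IsTangentToVertical (F : Type*) [NormedAddCommGroup F] [NormedSpace ℝ F]
    {M : Type*} [TopologicalSpace M] [ChartedSpace F M]
    (Q : ComplexAlmostContactMetricStructure E Mb) (f : M → Mb) : Prop :=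
  ∀ i, ∀ x : M, f x ∈ Q.dom i →
    Q.U i (f x) ∈ tangentImage (F := F) f x ∧ Q.V i (f x) ∈ tangentImage (F := F) f x

/-- The screen distribution contains `J(TM^⊥)`, `G(TM^⊥)`, `H(TM^⊥)` and the vertical
subbundle. -/
def IsAdaptedScreen (Q : ComplexAlmostContactMetricStructure E Mb) (f : M → Mb)
    (S : (x : M) → Submodule ℝ (TangentSpace 𝓘(ℝ, F) x)) : Prop :=
  ∀ i, ∀ x : M, f x ∈ Q.dom i →
    (∀ ξ ∈ normalSpace F Q.g f x,
      cpxJ (f x) ξ ∈ (S x).map (mfderiv 𝓘(ℝ, F) 𝓘(ℝ, E) f x).toLinearMap ∧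
      Q.G i (f x) ξ ∈ (S x).map (mfderiv 𝓘(ℝ, F) 𝓘(ℝ, E) f x).toLinearMap ∧
      Q.H i (f x) ξ ∈ (S x).map (mfderiv 𝓘(ℝ, F) 𝓘(ℝ, E) f x).toLinearMap) ∧
    Q.U i (f x) ∈ (S x).map (mfderiv 𝓘(ℝ, F) 𝓘(ℝ, E) f x).toLinearMap ∧
    Q.V i (f x) ∈ (S x).map (mfderiv 𝓘(ℝ, F) 𝓘(ℝ, E) f x).toLinearMap

end Contact

end

/-!
Let `ξ` span the normal line of the null hypersurface and let `N` be a section of the null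
transversal bundle, so that `g(N, ξ)` vanishes only where `N` does.

The first claim holds for every null hypersurface, because the Killing equation is not linear over
functions: `(£_{φN} g)(ξ, ξ) = φ (£_N g)(ξ, ξ) + 2 ξ(φ) g(N, ξ)`, so `N` and `φN` cannot both be
Killing at a point where `ξ(φ) ≠ 0` and `N ≠ 0` (`not_isKillingTransversal`). This needs a local
section with `N ≠ 0`, which comes from Cramer's rule for the Gram matrix of a screen frame
(`exists_isTransversalSectionOn`) and is made global with a bump function.

The second claim is pointwise (`IsTransversalSectionOn.eq_zero_of_isKillingAlongAt`). With an
adapted screen, `N` is orthogonal to `U`, `V`, `Gξ`, `Hξ`. The formula for `du` turns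
`(£_N g)(Gξ, U) = 0` into `g(Gξ, [U, N]) = 2 g(N, ξ)`; no connection is involved. On the other hand,
normality in the form `S(U, N) = 0` gives `g(Gξ, [U, N]) = -g(ξ, [U, GN])`
(`ComplexContactMetricStructure.IsNormal.g_G_mlieBracket`). Both `U` and `GN` are tangent to the
hypersurface along it, hence so is their bracket, and the right-hand side vanishes. Therefore
`g(N, ξ) = 0` and `N = 0`.

Vector fields along the immersion are extended to the ambient manifold with a local smooth
retraction (`IsLocalRetraction`), read off from the straightening charts of the immersion. The same
retraction `r` provides local equations `e ∘ f ∘ r = e` of the hypersurface, `e` a chart, which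
together with `dφ[X, Y] = X(Yφ) - Y(Xφ)` (`mvfderiv_mlieBracket`) show that brackets of tangent
fields are tangent (`IsLocalRetraction.mlieBracket_mem_tangentImage`).
-/

/-! ### Lie brackets as commutators of derivations -/

open VectorField in
/-- The derivative of a vector-valued function along a vector field, computed in a chart. -/
theorem mvfderiv_apply_eq_fderiv_extChartAt {E : Type*} [NormedAddCommGroup E] [NormedSpace ℝ E]
    {M : Type*} [TopologicalSpace M] [ChartedSpace E M] [IsManifold 𝓘(ℝ, E) 1 M]
    {G : Type*} [NormedAddCommGroup G] [NormedSpace ℝ G]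
    {φ : M → G} (Z : (x : M) → TangentSpace 𝓘(ℝ, E) x) {p : M} {z : E}
    (hz : z ∈ (extChartAt 𝓘(ℝ, E) p).target)
    (hφ : MDifferentiableAt 𝓘(ℝ, E) 𝓘(ℝ, G) φ ((extChartAt 𝓘(ℝ, E) p).symm z)) :
    mvfderiv 𝓘(ℝ, E) φ ((extChartAt 𝓘(ℝ, E) p).symm z) (Z ((extChartAt 𝓘(ℝ, E) p).symm z)) =
      fderiv ℝ (φ ∘ (extChartAt 𝓘(ℝ, E) p).symm) z
        (mpullbackWithin 𝓘(ℝ, E) 𝓘(ℝ, E) (extChartAt 𝓘(ℝ, E) p).symm Z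
          (Set.range 𝓘(ℝ, E)) z : E) := by
  have hinv := isInvertible_mfderivWithin_extChartAt_symm (I := 𝓘(ℝ, E)) hz
  have hd := mdifferentiableWithinAt_extChartAt_symm (I := 𝓘(ℝ, E)) hz
  have hcomp := mfderiv_comp_mfderivWithin z hφ hd
    ((𝓘(ℝ, E)).uniqueMDiffOn _ (extChartAt_target_subset_range p hz))
  have h2 : mfderivWithin 𝓘(ℝ, E) 𝓘(ℝ, G) (φ ∘ (extChartAt 𝓘(ℝ, E) p).symm)
      (Set.range 𝓘(ℝ, E)) z = fderiv ℝ (φ ∘ (extChartAt 𝓘(ℝ, E) p).symm) z := by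
    rw [mfderivWithin_eq_fderivWithin, modelWithCornersSelf_coe, Set.range_id, fderivWithin_univ]
  rw [← h2, hcomp]
  simp only [mpullbackWithin_apply]
  obtain ⟨L, hL⟩ := hinv
  rw [← hL, ContinuousLinearMap.inverse_equiv]
  exact congrArg (mfderiv 𝓘(ℝ, E) 𝓘(ℝ, G) φ ((extChartAt 𝓘(ℝ, E) p).symm z))
    (L.apply_symm_apply (Z ((extChartAt 𝓘(ℝ, E) p).symm z))).symm

open VectorField in
/-- The Lie bracket acts on functions as a commutator: `dφ[V, W] = V(Wφ) - W(Vφ)`. -/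
theorem mvfderiv_mlieBracket {E : Type*} [NormedAddCommGroup E] [NormedSpace ℝ E] [CompleteSpace E]
    {M : Type*} [TopologicalSpace M] [ChartedSpace E M] [IsManifold 𝓘(ℝ, E) ∞ M]
    {G : Type*} [NormedAddCommGroup G] [NormedSpace ℝ G]
    {φ : M → G} {V W : (x : M) → TangentSpace 𝓘(ℝ, E) x} {p : M}
    (hφ : ContMDiffAt 𝓘(ℝ, E) 𝓘(ℝ, G) 2 φ p)
    (hV : MDifferentiableAt 𝓘(ℝ, E) 𝓘(ℝ, E).tangent
      (fun x => (Bundle.TotalSpace.mk' E x (V x) : TangentBundle 𝓘(ℝ, E) M)) p)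
    (hW : MDifferentiableAt 𝓘(ℝ, E) 𝓘(ℝ, E).tangent
      (fun x => (Bundle.TotalSpace.mk' E x (W x) : TangentBundle 𝓘(ℝ, E) M)) p)
    (hdV : MDifferentiableAt 𝓘(ℝ, E) 𝓘(ℝ, G) (fun y => mvfderiv 𝓘(ℝ, E) φ y (V y)) p)
    (hdW : MDifferentiableAt 𝓘(ℝ, E) 𝓘(ℝ, G) (fun y => mvfderiv 𝓘(ℝ, E) φ y (W y)) p) :
    mvfderiv 𝓘(ℝ, E) φ p (mlieBracket 𝓘(ℝ, E) V W p) =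
      mvfderiv 𝓘(ℝ, E) (fun y => mvfderiv 𝓘(ℝ, E) φ y (W y)) p (V p)
      - mvfderiv 𝓘(ℝ, E) (fun y => mvfderiv 𝓘(ℝ, E) φ y (V y)) p (W p) := by
  set e := extChartAt 𝓘(ℝ, E) p with he
  have hl : e.symm (e p) = p := extChartAt_to_inv p
  have hz : e p ∈ e.target := mem_extChartAt_target p
  have hφd : ∀ᶠ y in 𝓝 p, MDifferentiableAt 𝓘(ℝ, E) 𝓘(ℝ, G) φ y := by
    filter_upwards [(contMDiffAt_iff_contMDiffAt_nhds (by decide)).1 hφ] with y hy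
      using hy.mdifferentiableAt two_ne_zero
  have hec : ContinuousAt e.symm (e p) := continuousAt_extChartAt_symm p
  have hφz : ∀ᶠ z in 𝓝 (e p), MDifferentiableAt 𝓘(ℝ, E) 𝓘(ℝ, G) φ (e.symm z) :=
    hec.eventually (by rwa [hl])
  have htar : e.target ∈ 𝓝 (e p) := extChartAt_target_mem_nhds p
  let V' : E → E := mpullbackWithin 𝓘(ℝ, E) 𝓘(ℝ, E) e.symm V (Set.range 𝓘(ℝ, E))
  let W' : E → E := mpullbackWithin 𝓘(ℝ, E) 𝓘(ℝ, E) e.symm W (Set.range 𝓘(ℝ, E))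
  have hV' : DifferentiableAt ℝ V' (e p) := by
    rw [← mdifferentiableWithinAt_univ] at hV
    exact hV.differentiableWithinAt_mpullbackWithin_vectorField.differentiableAt (by simp)
  have hW' : DifferentiableAt ℝ W' (e p) := by
    rw [← mdifferentiableWithinAt_univ] at hW
    exact hW.differentiableWithinAt_mpullbackWithin_vectorField.differentiableAt (by simp)
  have hφ' : ContDiffAt ℝ 2 (φ ∘ e.symm) (e p) := by
    have := (hl.symm ▸ hφ : ContMDiffAt 𝓘(ℝ, E) 𝓘(ℝ, G) 2 φ (e.symm (e p))).comp (e p)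
      (((contMDiffOn_extChartAt_symm (n := 2) p) _ hz).contMDiffAt htar)
    exact this.contDiffAt
  have hfd : DifferentiableAt ℝ (fderiv ℝ (φ ∘ e.symm)) (e p) :=
    (hφ'.fderiv_right (m := 1) (by norm_num)).differentiableAt one_ne_zero
  -- the second derivative of `φ` along two vector fields, read in the chart
  have second : ∀ (A B : (x : M) → TangentSpace 𝓘(ℝ, E) x) (A' B' : E → E),
      A' = mpullbackWithin 𝓘(ℝ, E) 𝓘(ℝ, E) e.symm A (Set.range 𝓘(ℝ, E)) →
      B' = mpullbackWithin 𝓘(ℝ, E) 𝓘(ℝ, E) e.symm B (Set.range 𝓘(ℝ, E)) →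
      DifferentiableAt ℝ B' (e p) →
      MDifferentiableAt 𝓘(ℝ, E) 𝓘(ℝ, G) (fun y => mvfderiv 𝓘(ℝ, E) φ y (B y)) p →
      mvfderiv 𝓘(ℝ, E) (fun y => mvfderiv 𝓘(ℝ, E) φ y (B y)) p (A p) =
        fderiv ℝ (fderiv ℝ (φ ∘ e.symm)) (e p) (A' (e p)) (B' (e p))
          + fderiv ℝ (φ ∘ e.symm) (e p) (fderiv ℝ B' (e p) (A' (e p))) := by
    intro A B A' B' hA hB hB' hd
    have h1 := mvfderiv_apply_eq_fderiv_extChartAt A hz (by rw [← he, hl]; exact hd)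
    rw [← he, hl] at h1
    rw [h1]
    have h2 : (fun y => mvfderiv 𝓘(ℝ, E) φ y (B y)) ∘ e.symm =ᶠ[𝓝 (e p)]
        fun z => fderiv ℝ (φ ∘ e.symm) z (B' z) := by
      filter_upwards [htar, hφz] with z hz1 hz2
      rw [hB]
      exact mvfderiv_apply_eq_fderiv_extChartAt B hz1 hz2
    rw [h2.fderiv_eq, fderiv_clm_apply hfd hB', ← hA]
    simp [add_comm]
  rw [second V W V' W' rfl rfl hW' hdW, second W V W' V' rfl rfl hV' hdV]
  have hsym : IsSymmSndFDerivAt ℝ (φ ∘ e.symm) (e p) :=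
    hφ'.isSymmSndFDerivAt (by simp)
  rw [hsym.eq (V' (e p)) (W' (e p))]
  have h1 := mvfderiv_apply_eq_fderiv_extChartAt (mlieBracket 𝓘(ℝ, E) V W) hz
    (by rw [← he, hl]; exact hφd.self_of_nhds)
  rw [← he, hl] at h1
  have h3 : (mpullbackWithin 𝓘(ℝ, E) 𝓘(ℝ, E) e.symm (mlieBracket 𝓘(ℝ, E) V W)
      (Set.range 𝓘(ℝ, E)) (e p) : E) = lieBracket ℝ V' W' (e p) := by
    rw [mpullbackWithin_apply, hl]
    have := mfderivWithin_extChartAt_symm_inverse_apply (I := 𝓘(ℝ, E)) (x := p)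
      (mlieBracket 𝓘(ℝ, E) V W p)
    refine this.trans ?_
    rw [mlieBracket, mlieBracketWithin_apply, mfderiv_extChartAt_self]
    have hid : ∀ b : E, (ContinuousLinearMap.id ℝ E).inverse b = b := by simp
    refine (hid _).trans ?_
    change lieBracketWithin ℝ V' W' (e.symm ⁻¹' Set.univ ∩ Set.range 𝓘(ℝ, E)) (e p) = _
    rw [Set.preimage_univ, Set.univ_inter, modelWithCornersSelf_coe, Set.range_id,
      lieBracketWithin_univ]
  rw [h1, h3, lieBracket_eq]
  simp

/-! ### Smooth sections along a map -/

section Along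

variable {E : Type*} [NormedAddCommGroup E] [NormedSpace ℝ E]
  {B : Type*} [TopologicalSpace B] [ChartedSpace E B]
  {F : Type*} [NormedAddCommGroup F] [NormedSpace ℝ F]
  {M : Type*} [TopologicalSpace M] [ChartedSpace F M]

/-- `v` is a smooth vector field along the map `b`, over the set `s`. -/
def IsSmoothAlongOn (E : Type*) [NormedAddCommGroup E] [NormedSpace ℝ E]
    {B : Type*} [TopologicalSpace B] [ChartedSpace E B]
    (F : Type*) [NormedAddCommGroup F] [NormedSpace ℝ F]
    {M : Type*} [TopologicalSpace M] [ChartedSpace F M] [IsManifold 𝓘(ℝ, E) 1 B] (b : M → B)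
    (v : (m : M) → TangentSpace 𝓘(ℝ, E) (b m)) (s : Set M) : Prop :=
  ContMDiffOn 𝓘(ℝ, F) 𝓘(ℝ, E).tangent ∞
    (fun m => (Bundle.TotalSpace.mk' E (b m) (v m) : TangentBundle 𝓘(ℝ, E) B)) s

variable [IsManifold 𝓘(ℝ, E) ∞ B] {b : M → B} {v w : (m : M) → TangentSpace 𝓘(ℝ, E) (b m)}
  {s : Set M}

theorem IsSmoothAlongOn.base (hv : IsSmoothAlongOn E F b v s) :
    ContMDiffOn 𝓘(ℝ, F) 𝓘(ℝ, E) ∞ b s :=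
  fun x hx => (Bundle.contMDiffWithinAt_totalSpace.1 (hv x hx)).1

theorem IsSmoothAlongOn.add (hv : IsSmoothAlongOn E F b v s) (hw : IsSmoothAlongOn E F b w s) :
    IsSmoothAlongOn E F b (fun m => v m + w m) s := by
  intro x hx
  have h1 := Bundle.contMDiffWithinAt_totalSpace.1 (hv x hx)
  have h2 := Bundle.contMDiffWithinAt_totalSpace.1 (hw x hx)
  refine Bundle.contMDiffWithinAt_totalSpace.2 ⟨h1.1, (h1.2.add h2.2).congr_of_eventuallyEq_of_mem
    ?_ hx⟩
  filter_upwards [h1.1.continuousWithinAt.preimage_mem_nhdsWithin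
    ((trivializationAt E (TangentSpace 𝓘(ℝ, E)) (b x)).open_baseSet.mem_nhds
      (FiberBundle.mem_baseSet_trivializationAt' (b x)))] with y hy
  exact ((trivializationAt E (TangentSpace 𝓘(ℝ, E)) (b x)).linear ℝ hy).map_add (v y) (w y)

theorem IsSmoothAlongOn.smul {c : M → ℝ} (hc : ContMDiffOn 𝓘(ℝ, F) 𝓘(ℝ, ℝ) ∞ c s)
    (hv : IsSmoothAlongOn E F b v s) : IsSmoothAlongOn E F b (fun m => c m • v m) s := by
  intro x hx
  have h1 := Bundle.contMDiffWithinAt_totalSpace.1 (hv x hx)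
  refine Bundle.contMDiffWithinAt_totalSpace.2 ⟨h1.1,
    ((hc x hx).smul h1.2).congr_of_eventuallyEq_of_mem ?_ hx⟩
  filter_upwards [h1.1.continuousWithinAt.preimage_mem_nhdsWithin
    ((trivializationAt E (TangentSpace 𝓘(ℝ, E)) (b x)).open_baseSet.mem_nhds
      (FiberBundle.mem_baseSet_trivializationAt' (b x)))] with y hy
  exact ((trivializationAt E (TangentSpace 𝓘(ℝ, E)) (b x)).linear ℝ hy).map_smul (c y) (v y)

theorem isSmoothAlongOn_zero (hb : ContMDiffOn 𝓘(ℝ, F) 𝓘(ℝ, E) ∞ b s) :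
    IsSmoothAlongOn E F b (fun _ => 0) s :=
  fun x hx => (((Bundle.contMDiff_zeroSection ℝ
    (TangentSpace 𝓘(ℝ, E) (M := B))).contMDiffAt.of_le le_top).comp_contMDiffWithinAt x (hb x hx))

theorem IsSmoothAlongOn.sum {ι : Type*} (t : Finset ι)
    {u : ι → (m : M) → TangentSpace 𝓘(ℝ, E) (b m)} (hb : ContMDiffOn 𝓘(ℝ, F) 𝓘(ℝ, E) ∞ b s)
    (hu : ∀ k ∈ t, IsSmoothAlongOn E F b (u k) s) :
    IsSmoothAlongOn E F b (fun m => ∑ k ∈ t, u k m) s := by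
  classical
  induction t using Finset.induction_on with
  | empty => simpa using isSmoothAlongOn_zero hb
  | insert a t ha ih =>
    simp only [Finset.sum_insert ha]
    exact (hu a (by simp)).add (ih fun k hk => hu k (by simp [hk]))

/-- The metric product of two smooth vector fields along a map is a smooth function. -/
theorem SemiRiemannianMetric.contMDiffOn_val (g : SemiRiemannianMetric E B)
    (hv : IsSmoothAlongOn E F b v s) (hw : IsSmoothAlongOn E F b w s) :
    ContMDiffOn 𝓘(ℝ, F) 𝓘(ℝ, ℝ) ∞ (fun m => g.val (b m) (v m) (w m)) s := by
  intro x hx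
  have : ContMDiffWithinAt 𝓘(ℝ, F) (𝓘(ℝ, E).prod 𝓘(ℝ)) ∞
      (fun m ↦ Bundle.TotalSpace.mk' ℝ (E := Bundle.Trivial B ℝ) (b m) (g.val (b m) (v m) (w m)))
      s x := by
    apply ContMDiffWithinAt.clm_bundle_apply₂ (F₁ := E) (F₂ := E)
    · exact ContMDiffAt.comp_contMDiffWithinAt x g.smooth.contMDiffAt (hv.base x hx)
    · exact hv x hx
    · exact hw x hx
  exact (Bundle.contMDiffWithinAt_totalSpace.1 this).2

/-- The restriction to `f` of a vector field on the target is smooth along `f`. -/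
theorem IsVectorFieldOn.comp_isSmoothAlongOn {X : (y : B) → TangentSpace 𝓘(ℝ, E) y} {A : Set B}
    (hX : IsVectorFieldOn ∞ X A) (hb : ContMDiffOn 𝓘(ℝ, F) 𝓘(ℝ, E) ∞ b s)
    (hs : Set.MapsTo b s A) : IsSmoothAlongOn E F b (fun m => X (b m)) s :=
  ContMDiffOn.comp (g := fun y => (Bundle.TotalSpace.mk' E y (X y) : TangentBundle 𝓘(ℝ, E) B))
    hX hb hs

/-- The image under the derivative of `b` of a vector field on the source is smooth along `b`. -/
theorem IsVectorFieldOn.mfderiv_isSmoothAlongOn [IsManifold 𝓘(ℝ, F) ∞ M]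
    {Z : (y : M) → TangentSpace 𝓘(ℝ, F) y} (hZ : IsVectorFieldOn ∞ Z s) (hs : IsOpen s)
    (hb : ContMDiffOn 𝓘(ℝ, F) 𝓘(ℝ, E) ∞ b s) :
    IsSmoothAlongOn E F b (fun m => mfderiv 𝓘(ℝ, F) 𝓘(ℝ, E) b m (Z m)) s := by
  have h := (hb.contMDiffOn_tangentMapWithin (m := ∞) le_rfl hs.uniqueMDiffOn).comp hZ
    (fun x hx => hx)
  refine h.congr fun x hx => ?_
  simp only [Function.comp, tangentMapWithin, mfderivWithin_of_isOpen hs hx]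

theorem IsVectorFieldOn.contMDiffOn_mvfderiv [IsManifold 𝓘(ℝ, F) ∞ M]
    {G : Type*} [NormedAddCommGroup G] [NormedSpace ℝ G] {φ : M → G}
    {Z : (y : M) → TangentSpace 𝓘(ℝ, F) y} (hZ : IsVectorFieldOn ∞ Z s) (hs : IsOpen s)
    (hφ : ContMDiffOn 𝓘(ℝ, F) 𝓘(ℝ, G) ∞ φ s) :
    ContMDiffOn 𝓘(ℝ, F) 𝓘(ℝ, G) ∞ (fun m => mvfderiv 𝓘(ℝ, F) φ m (Z m)) s :=
  (contMDiff_snd_tangentBundle_modelSpace G 𝓘(ℝ, G)).comp_contMDiffOn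
    (hZ.mfderiv_isSmoothAlongOn hs hφ)

/-- Every tangent vector extends to a local smooth vector field. -/
theorem exists_isVectorFieldOn_eq (p : B) (a : TangentSpace 𝓘(ℝ, E) p) :
    ∃ (A : Set B) (X : (y : B) → TangentSpace 𝓘(ℝ, E) y),
      IsOpen A ∧ p ∈ A ∧ IsVectorFieldOn ∞ X A ∧ X p = a := by
  obtain ⟨s, hs, h⟩ := FiberBundle.exists_contMDiffOn_extend (k := ∞) 𝓘(ℝ, E) E a
  obtain ⟨A, hAs, hA, hpA⟩ := mem_nhds_iff.1 hs
  exact ⟨A, FiberBundle.extend E a, hA, hpA, h.mono hAs, by simp⟩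

end Along

/-! ### Local retractions of an immersion -/

section Retraction

variable {E : Type*} [NormedAddCommGroup E] [NormedSpace ℝ E]
  {Mb : Type*} [TopologicalSpace Mb] [ChartedSpace E Mb]
  {F : Type*} [NormedAddCommGroup F] [NormedSpace ℝ F]
  {M : Type*} [TopologicalSpace M] [ChartedSpace F M]

/-- `r` is a smooth local left inverse of `f` near `x`, defined on the open set `A`. -/
structure IsLocalRetraction (E : Type*) [NormedAddCommGroup E] [NormedSpace ℝ E]
    {Mb : Type*} [TopologicalSpace Mb] [ChartedSpace E Mb]
    (F : Type*) [NormedAddCommGroup F] [NormedSpace ℝ F]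
    {M : Type*} [TopologicalSpace M] [ChartedSpace F M]
    (f : M → Mb) (x : M) (A : Set Mb) (r : Mb → M) : Prop where
  isOpen : IsOpen A
  mem : f x ∈ A
  contMDiffOn : ContMDiffOn 𝓘(ℝ, E) 𝓘(ℝ, F) ∞ r A
  leftInverse : ∀ᶠ y in 𝓝 x, r (f y) = y

theorem Manifold.IsImmersionAt.exists_isLocalRetraction {f : M → Mb} {x : M}
    (hf : Manifold.IsImmersionAt 𝓘(ℝ, F) 𝓘(ℝ, E) ∞ f x) :
    ∃ A r, IsLocalRetraction E F f x A r := by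
  obtain ⟨C, _, _, h⟩ := hf
  have hψ : ContMDiffOn 𝓘(ℝ, E) 𝓘(ℝ, E) ∞ h.codChart h.codChart.source :=
    contMDiffOn_of_mem_maximalAtlas h.codChart_mem_maximalAtlas
  have hφ : ContMDiffOn 𝓘(ℝ, F) 𝓘(ℝ, F) ∞ h.domChart.symm h.domChart.target :=
    contMDiffOn_symm_of_mem_maximalAtlas h.domChart_mem_maximalAtlas
  -- in the straightening charts the retraction is the projection to the first factor
  let L : E →L[ℝ] F := (ContinuousLinearMap.fst ℝ F C).comp h.equiv.symm.toContinuousLinearMap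
  have hLψ : ContMDiffOn 𝓘(ℝ, E) 𝓘(ℝ, F) ∞ (fun z => L (h.codChart z)) h.codChart.source :=
    L.contMDiff.comp_contMDiffOn hψ
  have hL : ∀ y ∈ h.domChart.source, L (h.codChart (f y)) = h.domChart y := by
    intro y hy
    have hy' : h.domChart y ∈ (h.domChart.extend 𝓘(ℝ, F)).target := by
      simpa using h.domChart.map_source hy
    have := h.writtenInCharts hy'
    simp only [Function.comp_apply, OpenPartialHomeomorph.extend_coe,
      OpenPartialHomeomorph.extend_coe_symm, modelWithCornersSelf_coe,
      modelWithCornersSelf_coe_symm, id_eq, h.domChart.left_inv hy] at this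
    simp [L, this]
  refine ⟨h.codChart.source ∩ (fun z => L (h.codChart z)) ⁻¹' h.domChart.target,
    fun z => h.domChart.symm (L (h.codChart z)),
    hLψ.continuousOn.isOpen_inter_preimage h.codChart.open_source h.domChart.open_target,
    ⟨h.mem_codChart_source, ?_⟩, ?_, ?_⟩
  · rw [Set.mem_preimage, hL x h.mem_domChart_source]
    exact h.domChart.map_source h.mem_domChart_source
  · exact hφ.comp (hLψ.mono Set.inter_subset_left) fun z hz => hz.2
  · filter_upwards [h.domChart.open_source.mem_nhds h.mem_domChart_source] with y hy
    rw [hL y hy, h.domChart.left_inv hy]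

variable {f : M → Mb} {x : M} {A : Set Mb} {r : Mb → M}

theorem IsLocalRetraction.mfderiv_apply_mfderiv (h : IsLocalRetraction E F f x A r)
    (hf : MDifferentiableAt 𝓘(ℝ, F) 𝓘(ℝ, E) f x) (a : TangentSpace 𝓘(ℝ, F) x) :
    (mfderiv 𝓘(ℝ, E) 𝓘(ℝ, F) r (f x) (mfderiv 𝓘(ℝ, F) 𝓘(ℝ, E) f x a) : F) = a := by
  have hr : MDifferentiableAt 𝓘(ℝ, E) 𝓘(ℝ, F) r (f x) :=
    (h.contMDiffOn.contMDiffAt (h.isOpen.mem_nhds h.mem)).mdifferentiableAt (by simp)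
  have h1 := mfderiv_comp_apply x hr hf a
  have h2 : r ∘ f =ᶠ[𝓝 x] id := h.leftInverse
  rw [h2.mfderiv_eq] at h1
  rw [← h1]
  simp
  rfl

theorem IsLocalRetraction.injective_mfderiv (h : IsLocalRetraction E F f x A r)
    (hf : MDifferentiableAt 𝓘(ℝ, F) 𝓘(ℝ, E) f x) :
    Function.Injective (mfderiv 𝓘(ℝ, F) 𝓘(ℝ, E) f x) := fun a b hab => by
  have := h.mfderiv_apply_mfderiv hf a
  rw [hab] at this
  exact this.symm.trans (h.mfderiv_apply_mfderiv hf b)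

/-- A smooth vector field along `f` extends, near a point, to a vector field of the target. -/
theorem IsLocalRetraction.exists_extension [IsManifold 𝓘(ℝ, E) ∞ Mb]
    (h : IsLocalRetraction E F f x A r)
    {W : Set M} (hW : IsOpen W) (hx : x ∈ W) {N : (y : M) → TangentSpace 𝓘(ℝ, E) (f y)}
    (hN : IsSmoothAlongOn E F f N W) :
    ∃ (A' : Set Mb) (N' : (y : Mb) → TangentSpace 𝓘(ℝ, E) y), IsOpen A' ∧ f x ∈ A' ∧ A' ⊆ A ∧
      IsVectorFieldOn ∞ N' A' ∧ ∀ᶠ y in 𝓝 x, N' (f y) = N y := by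
  set t := trivializationAt E (TangentSpace 𝓘(ℝ, E)) (f x) with ht
  have hrx : r (f x) = x := h.leftInverse.self_of_nhds
  have hbW : IsOpen (W ∩ f ⁻¹' t.baseSet) :=
    hN.base.continuousOn.isOpen_inter_preimage hW t.open_baseSet
  have hxt : f x ∈ t.baseSet := FiberBundle.mem_baseSet_trivializationAt' (f x)
  let A' : Set Mb := (A ∩ r ⁻¹' (W ∩ f ⁻¹' t.baseSet)) ∩ t.baseSet
  have hA' : IsOpen A' :=
    (h.contMDiffOn.continuousOn.isOpen_inter_preimage h.isOpen hbW).inter t.open_baseSet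
  have hA'x : f x ∈ A' := ⟨⟨h.mem, by
    rw [Set.mem_preimage, hrx]; exact ⟨hx, hxt⟩⟩, hxt⟩
  let c : M → E := fun y => (t ⟨f y, N y⟩).2
  have hc : ContMDiffOn 𝓘(ℝ, F) 𝓘(ℝ, E) ∞ c (W ∩ f ⁻¹' t.baseSet) :=
    ((t.contMDiffOn_iff (fun y hy => (t.mem_source).2 hy.2)).1
      (hN.mono Set.inter_subset_left)).2
  refine ⟨A', fun z => t.symm z (c (r z)), hA', hA'x, fun z hz => hz.1.1, ?_, ?_⟩
  · refine (t.contMDiffOn_section_iff hA' (fun z hz => hz.2)).2 ?_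
    refine (hc.comp (h.contMDiffOn.mono fun z hz => hz.1.1) fun z hz => hz.1.2).congr ?_
    intro z hz
    simp [t.apply_mk_symm hz.2]
  · filter_upwards [h.leftInverse, hbW.mem_nhds ⟨hx, hxt⟩] with y hy hy2
    rw [hy]
    exact t.symm_apply_apply_mk hy2.2 (N y)

end Retraction

/-! ### Fields tangent to an immersed manifold -/

section Tangency

variable {E : Type*} [NormedAddCommGroup E] [NormedSpace ℝ E]
  {Mb : Type*} [TopologicalSpace Mb] [ChartedSpace E Mb] [IsManifold 𝓘(ℝ, E) ∞ Mb]
  {F : Type*} [NormedAddCommGroup F] [NormedSpace ℝ F]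
  {M : Type*} [TopologicalSpace M] [ChartedSpace F M]
  {f : M → Mb} {x : M} {A : Set Mb} {r : Mb → M}

omit [IsManifold 𝓘(ℝ, E) ∞ Mb] in
/-- The chain rule for functions with values in a normed space. -/
theorem mvfderiv_comp_apply_vec {G : Type*} [NormedAddCommGroup G] [NormedSpace ℝ G] {φ : Mb → G}
    {p : Mb} (hp : f x = p) (hφ : MDifferentiableAt 𝓘(ℝ, E) 𝓘(ℝ, G) φ p)
    (hf : MDifferentiableAt 𝓘(ℝ, F) 𝓘(ℝ, E) f x) (w : TangentSpace 𝓘(ℝ, F) x) :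
    mvfderiv 𝓘(ℝ, F) (φ ∘ f) x w =
      mvfderiv 𝓘(ℝ, E) φ p (mfderiv 𝓘(ℝ, F) 𝓘(ℝ, E) f x w) :=
  mfderiv_comp_apply_of_eq x hφ hf hp w

omit [IsManifold 𝓘(ℝ, E) ∞ Mb] in
/-- If `φ` vanishes along `f`, then the derivative of `φ` in a direction tangent to `f` vanishes. -/
theorem mvfderiv_eq_zero_of_comp_eventuallyEq_zero {G : Type*} [NormedAddCommGroup G]
    [NormedSpace ℝ G] {φ : Mb → G} (hφ : MDifferentiableAt 𝓘(ℝ, E) 𝓘(ℝ, G) φ (f x))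
    (hf : MDifferentiableAt 𝓘(ℝ, F) 𝓘(ℝ, E) f x) (h0 : ∀ᶠ y in 𝓝 x, φ (f y) = 0)
    {a : TangentSpace 𝓘(ℝ, E) (f x)} (ha : a ∈ tangentImage (F := F) f x) :
    mvfderiv 𝓘(ℝ, E) φ (f x) a = 0 := by
  obtain ⟨w, rfl⟩ := ha
  have h1 := mvfderiv_comp_apply_vec rfl hφ hf w
  have h2 : φ ∘ f =ᶠ[𝓝 x] fun _ => (0 : G) := h0
  refine h1.symm.trans ?_
  have h3 : mfderiv 𝓘(ℝ, F) 𝓘(ℝ, G) (φ ∘ f) x = mfderiv 𝓘(ℝ, F) 𝓘(ℝ, G) (fun _ => (0 : G)) x :=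
    h2.mfderiv_eq
  have h4 : mvfderiv 𝓘(ℝ, F) (φ ∘ f) x w = mfderiv 𝓘(ℝ, F) 𝓘(ℝ, G) (φ ∘ f) x w := rfl
  rw [h4, h3, mfderiv_const]
  rfl

open VectorField in
/-- Vector fields tangent to an immersed manifold have a tangent Lie bracket. The tangent spaces
are the kernels of the derivative of `e ∘ f ∘ r - e`, where `r` is a local retraction and `e` a
chart, and this function vanishes along the immersion. -/
theorem IsLocalRetraction.mlieBracket_mem_tangentImage [CompleteSpace E]
    (h : IsLocalRetraction E F f x A r) (hf : ContMDiff 𝓘(ℝ, F) 𝓘(ℝ, E) ∞ f)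
    {X Y : (y : Mb) → TangentSpace 𝓘(ℝ, E) y} {B : Set Mb} (hB : IsOpen B) (hxB : f x ∈ B)
    (hX : IsVectorFieldOn ∞ X B) (hY : IsVectorFieldOn ∞ Y B)
    (hXt : ∀ᶠ y in 𝓝 x, X (f y) ∈ tangentImage (F := F) f y)
    (hYt : ∀ᶠ y in 𝓝 x, Y (f y) ∈ tangentImage (F := F) f y) :
    mlieBracket 𝓘(ℝ, E) X Y (f x) ∈ tangentImage (F := F) f x := by
  have hrx : r (f x) = x := h.leftInverse.self_of_nhds
  set e := extChartAt 𝓘(ℝ, E) (f x) with he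
  have hesm : ContMDiffOn 𝓘(ℝ, E) 𝓘(ℝ, E) ∞ e e.source := by
    rw [he, extChartAt_source]; exact contMDiffOn_extChartAt
  have heo : IsOpen e.source := isOpen_extChartAt_source (f x)
  have hex : f x ∈ e.source := mem_extChartAt_source (f x)
  have hfr : ContMDiffOn 𝓘(ℝ, E) 𝓘(ℝ, E) ∞ (f ∘ r) A := hf.comp_contMDiffOn h.contMDiffOn
  let D : Set Mb := (B ∩ e.source) ∩ (A ∩ (f ∘ r) ⁻¹' e.source)
  have hD : IsOpen D :=
    (hB.inter heo).inter (hfr.continuousOn.isOpen_inter_preimage h.isOpen heo)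
  have hxD : f x ∈ D := ⟨⟨hxB, hex⟩, h.mem, by simpa [hrx] using hex⟩
  let φ : Mb → E := fun z => e (f (r z)) - e z
  have h1 : ContMDiffOn 𝓘(ℝ, E) 𝓘(ℝ, E) ∞ (e ∘ (f ∘ r)) D :=
    hesm.comp (hfr.mono fun z hz => hz.2.1) fun z hz => hz.2.2
  have h2 : ContMDiffOn 𝓘(ℝ, E) 𝓘(ℝ, E) ∞ e D := hesm.mono fun z hz => hz.1.2
  have hφ : ContMDiffOn 𝓘(ℝ, E) 𝓘(ℝ, E) ∞ φ D := h1.sub h2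
  have hDx : ∀ᶠ y in 𝓝 x, f y ∈ D := hf.continuous.continuousAt.preimage_mem_nhds (hD.mem_nhds hxD)
  have hφ0 : ∀ᶠ y in 𝓝 x, φ (f y) = 0 := by
    filter_upwards [h.leftInverse] with y hy
    simp [φ, hy]
  -- the derivative of `φ` along a tangent field vanishes along `f`
  have along : ∀ Z : (y : Mb) → TangentSpace 𝓘(ℝ, E) y,
      (∀ᶠ y in 𝓝 x, Z (f y) ∈ tangentImage (F := F) f y) →
      ∀ᶠ y in 𝓝 x, mvfderiv 𝓘(ℝ, E) φ (f y) (Z (f y)) = 0 := by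
    intro Z hZ
    filter_upwards [hZ, hDx, hφ0.eventually_nhds] with y hy1 hy2 hy3
    exact mvfderiv_eq_zero_of_comp_eventuallyEq_zero
      ((hφ.contMDiffAt (hD.mem_nhds hy2)).mdifferentiableAt (by simp))
      (hf.mdifferentiable (by simp) y) hy3 hy1
  have hXD : IsVectorFieldOn ∞ X D := hX.mono fun z hz => hz.1.1
  have hYD : IsVectorFieldOn ∞ Y D := hY.mono fun z hz => hz.1.1
  have hdX := ((hXD.contMDiffOn_mvfderiv hD hφ).contMDiffAt (hD.mem_nhds hxD)).mdifferentiableAt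
    (by simp)
  have hdY := ((hYD.contMDiffOn_mvfderiv hD hφ).contMDiffAt (hD.mem_nhds hxD)).mdifferentiableAt
    (by simp)
  have hfx := hf.mdifferentiable (by simp) x
  have key := mvfderiv_mlieBracket ((hφ.contMDiffAt (hD.mem_nhds hxD)).of_le ENat.LEInfty.out)
    ((ContMDiffOn.contMDiffAt hXD (hD.mem_nhds hxD)).mdifferentiableAt (by simp))
    ((ContMDiffOn.contMDiffAt hYD (hD.mem_nhds hxD)).mdifferentiableAt (by simp)) hdX hdY
  rw [mvfderiv_eq_zero_of_comp_eventuallyEq_zero hdY hfx (along Y hYt) hXt.self_of_nhds,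
    mvfderiv_eq_zero_of_comp_eventuallyEq_zero hdX hfx (along X hXt) hYt.self_of_nhds,
    sub_zero] at key
  set b := mlieBracket 𝓘(ℝ, E) X Y (f x) with hb
  have hdr : MDifferentiableAt 𝓘(ℝ, E) 𝓘(ℝ, F) r (f x) :=
    (h.contMDiffOn.contMDiffAt (h.isOpen.mem_nhds h.mem)).mdifferentiableAt (by simp)
  have hde : MDifferentiableAt 𝓘(ℝ, E) 𝓘(ℝ, E) e (f x) :=
    (hesm.contMDiffAt (heo.mem_nhds hex)).mdifferentiableAt (by simp)
  have hfr' : MDifferentiableAt 𝓘(ℝ, E) 𝓘(ℝ, E) (f ∘ r) (f x) :=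
    (hfr.contMDiffAt (h.isOpen.mem_nhds h.mem)).mdifferentiableAt (by simp)
  have hself : ∀ a : TangentSpace 𝓘(ℝ, E) (f x), mvfderiv 𝓘(ℝ, E) e (f x) a = a := fun a =>
    congrArg (fun L : E →L[ℝ] E => L a) (mfderiv_extChartAt_self (I := 𝓘(ℝ, E)) (x := f x))
  have c1 := mvfderiv_comp_apply_vec (f := f ∘ r) (x := f x) (by simp [hrx]) hde hfr' b
  have c2 := mfderiv_comp_apply_of_eq (f x) hfx hdr hrx b
  have c3 : mvfderiv 𝓘(ℝ, E) φ (f x) b =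
      mvfderiv 𝓘(ℝ, E) (e ∘ (f ∘ r)) (f x) b - mvfderiv 𝓘(ℝ, E) e (f x) b := by
    have := mvfderiv_sub ((h1.contMDiffAt (hD.mem_nhds hxD)).mdifferentiableAt (by simp)) hde
    exact congrArg (fun L : TangentSpace 𝓘(ℝ, E) (f x) →L[ℝ] E => L b) this
  have c4 := sub_eq_zero.1 (c3.symm.trans key)
  exact ⟨mfderiv 𝓘(ℝ, E) 𝓘(ℝ, F) r (f x) b,
    c2.symm.trans ((hself _).symm.trans (c1.symm.trans (c4.trans (hself b))))⟩

end Tangency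

/-! ### Linear algebra of null hypersurfaces -/

section NullGeometry

variable {E : Type*} [NormedAddCommGroup E] [NormedSpace ℝ E]
  {Mb : Type*} [TopologicalSpace Mb] [ChartedSpace E Mb] [IsManifold 𝓘(ℝ, E) ∞ Mb]
  {F : Type*} [NormedAddCommGroup F] [NormedSpace ℝ F]
  {M : Type*} [TopologicalSpace M] [ChartedSpace F M] [IsManifold 𝓘(ℝ, F) ∞ M]
  {g : SemiRiemannianMetric E Mb} {f : M → Mb} {m : ℕ}
  {S : (x : M) → Submodule ℝ (TangentSpace 𝓘(ℝ, F) x)}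

theorem IsNullHypersurface.exists_isLocalRetraction
    (h : IsNullHypersurface (F := F) g f m) (x : M) : ∃ A r, IsLocalRetraction E F f x A r := by
  obtain ⟨C, _, _, hC⟩ := h.immersion
  exact (hC x).isImmersionAt.exists_isLocalRetraction

theorem IsNullHypersurface.contMDiff (h : IsNullHypersurface (F := F) g f m) :
    ContMDiff 𝓘(ℝ, F) 𝓘(ℝ, E) ∞ f :=
  h.immersion.contMDiff

theorem IsNullHypersurface.injective_mfderiv (h : IsNullHypersurface (F := F) g f m) (x : M) :
    Function.Injective (mfderiv 𝓘(ℝ, F) 𝓘(ℝ, E) f x) := by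
  obtain ⟨A, r, hr⟩ := h.exists_isLocalRetraction x
  exact hr.injective_mfderiv (h.contMDiff.mdifferentiable (by simp) x)

/-- The normal line is spanned by the image of a nonzero tangent vector. -/
theorem IsNullHypersurface.exists_span_normal (h : IsNullHypersurface (F := F) g f m) (x : M) :
    ∃ a ∈ radical (F := F) g f x, a ≠ 0 ∧
      ∀ ξ ∈ normalSpace F g f x, ∃ t : ℝ, ξ = t • mfderiv 𝓘(ℝ, F) 𝓘(ℝ, E) f x a := by
  obtain ⟨A, -, hxA, Z, -, hZ⟩ := h.normal_distribution x
  obtain ⟨hli, hspan⟩ := hZ x hxA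
  refine ⟨Z 0 x, hspan ▸ Submodule.subset_span ⟨0, rfl⟩, hli.ne_zero 0, fun ξ hξ => ?_⟩
  obtain ⟨b, rfl⟩ := h.normal_le x hξ
  have hb : b ∈ radical (F := F) g f x := hξ
  rw [hspan, Set.range_unique, Submodule.mem_span_singleton] at hb
  obtain ⟨t, rfl⟩ := hb
  exact ⟨t, map_smul _ _ _⟩

/-- The tangent space of a null hypersurface is the orthogonal complement of its normal line. -/
theorem IsNullHypersurface.mem_tangentImage_of_orthogonal [FiniteDimensional ℝ E]
    (h : IsNullHypersurface (F := F) g f m) (x : M) {b : TangentSpace 𝓘(ℝ, E) (f x)}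
    (hb : ∀ ξ ∈ normalSpace F g f x, g.val (f x) ξ b = 0) :
    b ∈ tangentImage (F := F) f x := by
  obtain ⟨a, ha, ha0, -⟩ := h.exists_span_normal x
  set ξ := mfderiv 𝓘(ℝ, F) 𝓘(ℝ, E) f x a with hξ
  have hξ0 : ξ ≠ 0 := fun h0 => ha0 (h.injective_mfderiv x (by rw [← hξ, h0, map_zero]))
  let ℓ : E →ₗ[ℝ] ℝ := (g.val (f x) ξ).toLinearMap
  have hℓ : ℓ ≠ 0 := fun h0 => hξ0 (g.nondegenerate (f x) ξ fun c => LinearMap.congr_fun h0 c)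
  have hker : Module.finrank ℝ (LinearMap.ker ℓ) + 1 = Module.finrank ℝ E :=
    Module.Dual.finrank_ker_add_one_of_ne_zero hℓ
  let D : F →ₗ[ℝ] E := (mfderiv 𝓘(ℝ, F) 𝓘(ℝ, E) f x).toLinearMap
  have hle : LinearMap.range D ≤ LinearMap.ker ℓ := by
    rintro _ ⟨w, rfl⟩
    exact ha w
  have hrange : Module.finrank ℝ (LinearMap.range D) = Module.finrank ℝ F :=
    LinearMap.finrank_range_of_inj (h.injective_mfderiv x)
  have heq : LinearMap.range D = LinearMap.ker ℓ := by
    apply Submodule.eq_of_le_of_finrank_eq hle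
    have h1 := h.dim_ambient
    have h2 := h.dim_hypersurface
    omega
  have : b ∈ LinearMap.ker ℓ := hb ξ ha
  rw [← heq] at this
  exact this

/-- A vector orthogonal to a screen and to the normal line is normal. -/
theorem mem_normalSpace_of_orthogonal (hS : IsScreenDistribution g f m S) (x : M)
    {b : TangentSpace 𝓘(ℝ, E) (f x)}
    (h1 : ∀ Z ∈ S x, g.val (f x) b (mfderiv 𝓘(ℝ, F) 𝓘(ℝ, E) f x Z) = 0)
    (h2 : ∀ a ∈ radical (F := F) g f x, g.val (f x) b (mfderiv 𝓘(ℝ, F) 𝓘(ℝ, E) f x a) = 0) :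
    b ∈ normalSpace F g f x := by
  intro w
  have hw : w ∈ S x ⊔ radical (F := F) g f x := by
    rw [(hS.2 x).sup_eq_top]; trivial
  obtain ⟨Z, hZ, a, ha, rfl⟩ := Submodule.mem_sup.1 hw
  rw [map_add, map_add, h1 Z hZ, h2 a ha, add_zero]

/-- The generators of a fibre of the null transversal bundle: the vectors `N` with `g(N, ξ) = 1`
for some normal `ξ`, `g(N, N) = 0` and `g(N, Z) = 0` on the screen. -/
def IsNullTransversal (g : SemiRiemannianMetric E Mb) (f : M → Mb)
    (S : (x : M) → Submodule ℝ (TangentSpace 𝓘(ℝ, F) x)) (x : M)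
    (N : TangentSpace 𝓘(ℝ, E) (f x)) : Prop :=
  (∃ ξ ∈ normalSpace F g f x, g.val (f x) ξ N = 1) ∧ g.val (f x) N N = 0 ∧
    ∀ Z ∈ S x, g.val (f x) N (mfderiv 𝓘(ℝ, F) 𝓘(ℝ, E) f x Z) = 0

/-- Two null transversal vectors at a point are proportional: after scaling, their difference is
normal, hence a multiple of `ξ`, and comparing squares shows that this multiple is zero. -/
theorem IsNullTransversal.exists_eq_smul (h : IsNullHypersurface (F := F) g f m)
    (hS : IsScreenDistribution g f m S) {x : M} {N N' : TangentSpace 𝓘(ℝ, E) (f x)}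
    (hN : IsNullTransversal g f S x N) (hN' : IsNullTransversal g f S x N') :
    ∃ t : ℝ, N' = t • N := by
  obtain ⟨⟨ξ, hξ, hξN⟩, hNN, hNS⟩ := hN
  obtain ⟨⟨ξ', hξ', hξN'⟩, hNN', hNS'⟩ := hN'
  obtain ⟨a, ha, ha0, hspan⟩ := h.exists_span_normal x
  obtain ⟨s, hs⟩ := hspan ξ hξ
  set η := mfderiv 𝓘(ℝ, F) 𝓘(ℝ, E) f x a with hη
  set c := g.val (f x) η N with hc
  set c' := g.val (f x) η N' with hc'
  have hsc : s * c = 1 := by rw [← hξN, hs]; simp [hc]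
  have hc0 : c ≠ 0 := right_ne_zero_of_mul_eq_one hsc
  obtain ⟨s', hs'⟩ := hspan ξ' hξ'
  have hsc' : s' * c' = 1 := by rw [← hξN', hs']; simp [hc']
  have hc0' : c' ≠ 0 := right_ne_zero_of_mul_eq_one hsc'
  have hD : c • N' - c' • N ∈ normalSpace F g f x := by
    refine mem_normalSpace_of_orthogonal hS x (fun Z hZ => ?_) (fun b hb => ?_)
    · simp [hNS Z hZ, hNS' Z hZ]
    · obtain ⟨t, ht⟩ := hspan _ (show mfderiv 𝓘(ℝ, F) 𝓘(ℝ, E) f x b ∈ normalSpace F g f x from hb)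
      rw [ht]
      simp only [map_sub, map_smul, sub_apply, smul_apply, smul_eq_mul]
      rw [g.symm _ N' η, g.symm _ N η, ← hc, ← hc']
      ring
  obtain ⟨t, ht⟩ := hspan _ hD
  have ht0 : t = 0 := by
    have h1 : c • N' = c' • N + t • η := by rw [← ht]; abel
    have h2 : g.val (f x) (c • N') (c • N') = 0 := by simp [hNN']
    have hηη : g.val (f x) η η = 0 := ha a
    rw [h1] at h2
    simp only [map_add, map_smul, add_apply, smul_apply, smul_eq_mul, hNN, hηη] at h2
    rw [g.symm _ N η, ← hc] at h2
    have h3 : t * (c' * c) = 0 := by linarith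
    exact (mul_eq_zero.1 h3).resolve_right (mul_ne_zero hc0' hc0)
  rw [ht0, zero_smul, sub_eq_zero] at ht
  refine ⟨c⁻¹ * c', ?_⟩
  rw [mul_smul, ← ht, smul_smul, inv_mul_cancel₀ hc0, one_smul]

omit [IsManifold 𝓘(ℝ, F) ∞ M] in
theorem apply_eq_zero_of_mem_transversalSpace {x : M} {N : TangentSpace 𝓘(ℝ, E) (f x)}
    (hN : N ∈ transversalSpace g f S x) {Z : TangentSpace 𝓘(ℝ, F) x} (hZ : Z ∈ S x) :
    g.val (f x) N (mfderiv 𝓘(ℝ, F) 𝓘(ℝ, E) f x Z) = 0 := by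
  induction hN using Submodule.span_induction with
  | mem N h => exact h.2.2 Z hZ
  | zero => simp
  | add N N' _ _ h h' => simp [h, h']
  | smul c N _ h => simp [h]

/-- Since the generators of a fibre of the null transversal bundle are proportional, every nonzero
element of the fibre is a multiple of a generator and pairs nontrivially with the normal line. -/
theorem eq_zero_of_mem_transversalSpace (h : IsNullHypersurface (F := F) g f m)
    (hS : IsScreenDistribution g f m S) {x : M} {N : TangentSpace 𝓘(ℝ, E) (f x)}
    (hN : N ∈ transversalSpace g f S x)
    (h0 : ∀ ξ ∈ normalSpace F g f x, g.val (f x) ξ N = 0) : N = 0 := by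
  by_cases hex : ∃ N₁, IsNullTransversal g f S x N₁
  · obtain ⟨N₁, hN₁⟩ := hex
    have hle : transversalSpace g f S x ≤ Submodule.span ℝ {N₁} := by
      refine Submodule.span_le.2 fun N' hN' => ?_
      obtain ⟨t, ht⟩ := hN₁.exists_eq_smul h hS hN'
      exact Submodule.mem_span_singleton.2 ⟨t, ht.symm⟩
    obtain ⟨t, rfl⟩ := Submodule.mem_span_singleton.1 (hle hN)
    obtain ⟨ξ, hξ, hξN⟩ := hN₁.1
    have := h0 ξ hξ
    rw [map_smul, hξN, smul_eq_mul, mul_one] at this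
    rw [this, zero_smul]
  · have : transversalSpace g f S x ≤ ⊥ :=
      Submodule.span_le.2 fun N' hN' => (hex ⟨N', hN'⟩).elim
    exact (Submodule.mem_bot ℝ).1 (this hN)

end NullGeometry

/-! ### Sections of the null transversal bundle -/

section Sections

variable {E : Type*} [NormedAddCommGroup E] [NormedSpace ℝ E]
  {Mb : Type*} [TopologicalSpace Mb] [ChartedSpace E Mb] [IsManifold 𝓘(ℝ, E) ∞ Mb]
  {F : Type*} [NormedAddCommGroup F] [NormedSpace ℝ F]
  {M : Type*} [TopologicalSpace M] [ChartedSpace F M] [IsManifold 𝓘(ℝ, F) ∞ M]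
  {g : SemiRiemannianMetric E Mb} {f : M → Mb} {m : ℕ}
  {S : (x : M) → Submodule ℝ (TangentSpace 𝓘(ℝ, F) x)}

omit [IsManifold 𝓘(ℝ, F) ∞ M] in
/-- The determinant of a matrix of smooth functions is smooth. -/
theorem contMDiffOn_det {ι : Type*} [Fintype ι] [DecidableEq ι] {s : Set M}
    {A : M → Matrix ι ι ℝ}
    (hA : ∀ i j, ContMDiffOn 𝓘(ℝ, F) 𝓘(ℝ, ℝ) ∞ (fun y => A y i j) s) :
    ContMDiffOn 𝓘(ℝ, F) 𝓘(ℝ, ℝ) ∞ (fun y => (A y).det) s := by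
  simp only [Matrix.det_apply']
  exact contMDiffOn_finsetSum fun p _ =>
    contMDiffOn_const.mul (contMDiffOn_finsetProd fun i _ => hA _ _)

/-- The Gram matrix of a basis of the screen is nonsingular. -/
theorem det_gram_screen_ne_zero (hS : IsScreenDistribution g f m S) {x : M}
    {Z : Fin m → TangentSpace 𝓘(ℝ, F) x} (hli : LinearIndependent ℝ Z)
    (hspan : S x = Submodule.span ℝ (Set.range Z)) :
    (Matrix.of fun j k => g.val (f x) (mfderiv 𝓘(ℝ, F) 𝓘(ℝ, E) f x (Z j))
      (mfderiv 𝓘(ℝ, F) 𝓘(ℝ, E) f x (Z k))).det ≠ 0 := by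
  intro hdet
  obtain ⟨c, hc0, hc⟩ := Matrix.exists_mulVec_eq_zero_iff.2 hdet
  let z : TangentSpace 𝓘(ℝ, F) x := ∑ k, c k • Z k
  have hzS : z ∈ S x := by
    rw [hspan]
    exact Submodule.sum_mem _ fun k _ => Submodule.smul_mem _ _ (Submodule.subset_span ⟨k, rfl⟩)
  have hz : mfderiv 𝓘(ℝ, F) 𝓘(ℝ, E) f x z ∈ normalSpace F g f x := by
    refine mem_normalSpace_of_orthogonal hS x (fun w hw => ?_) (fun b hb => ?_)
    · rw [hspan] at hw
      induction hw using Submodule.span_induction with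
      | mem w h =>
        obtain ⟨j, rfl⟩ := h
        have := congrFun hc j
        simp only [Matrix.mulVec, dotProduct, Matrix.of_apply, Pi.zero_apply] at this
        rw [g.symm]
        simp only [z, map_sum, map_smul, smul_eq_mul]
        rw [← this]
        exact Finset.sum_congr rfl fun k _ => mul_comm _ _
      | zero => simp
      | add w w' _ _ h h' => simp [h, h']
      | smul t w _ h => simp [h]
    · rw [g.symm]
      exact hb z
  have hz0 : z = 0 := (Submodule.disjoint_def.1 (hS.2 x).disjoint) z hzS hz
  exact hc0 (funext (Fintype.linearIndependent_iff.1 hli c hz0))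

/-- The null transversal bundle has a local section through every point that pairs nontrivially
with the normal line. With `A` the Gram matrix of a local screen frame `Z`, `w` a field with
`g(w, ξ) ≠ 0` and `c` given by Cramer's rule, the field `n = det A • w - ∑ c k • Z k` is orthogonal
to the screen, and subtracting a multiple of `ξ` makes it null. -/
theorem exists_isTransversalSectionOn (h : IsNullHypersurface (F := F) g f m)
    (hS : IsScreenDistribution g f m S) (x₀ : M) :
    ∃ (W : Set M) (N : (x : M) → TangentSpace 𝓘(ℝ, E) (f x)), IsOpen W ∧ x₀ ∈ W ∧
      IsTransversalSectionOn g f S N W ∧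
      ∃ a ∈ radical (F := F) g f x₀,
        g.val (f x₀) (mfderiv 𝓘(ℝ, F) 𝓘(ℝ, E) f x₀ a) (N x₀) ≠ 0 := by
  have hf := h.contMDiff
  obtain ⟨A₁, hA₁, hx₁, Z, hZ, hZS⟩ := hS.1 x₀
  obtain ⟨A₂, hA₂, hx₂, Ξ, hΞ, hΞR⟩ := h.normal_distribution x₀
  let D := fun y : M => mfderiv 𝓘(ℝ, F) 𝓘(ℝ, E) f y
  let ξ : (y : M) → TangentSpace 𝓘(ℝ, E) (f y) := fun y => D y (Ξ 0 y)
  have hrad : ∀ y ∈ A₂, Ξ 0 y ∈ radical (F := F) g f y := fun y hy => by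
    rw [(hΞR y hy).2]; exact Submodule.subset_span ⟨0, rfl⟩
  have hξ0 : ξ x₀ ≠ 0 := fun h0 => (hΞR x₀ hx₂).1.ne_zero 0
    (h.injective_mfderiv x₀ (by rw [map_zero]; exact h0))
  obtain ⟨w₀, hw₀⟩ : ∃ w₀, g.val (f x₀) (ξ x₀) w₀ ≠ 0 := by
    by_contra! hcon
    exact hξ0 (g.nondegenerate _ _ hcon)
  obtain ⟨A₃, w, hA₃, hx₃, hw, hww₀⟩ := exists_isVectorFieldOn_eq (f x₀) w₀
  let B : Set M := A₁ ∩ A₂ ∩ f ⁻¹' A₃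
  have hB : IsOpen B := (hA₁.inter hA₂).inter (hA₃.preimage hf.continuous)
  have hξs : IsSmoothAlongOn E F f ξ B :=
    (IsVectorFieldOn.mfderiv_isSmoothAlongOn (hΞ 0) hA₂ hf.contMDiffOn).mono fun y hy => hy.1.2
  have hZs : ∀ k, IsSmoothAlongOn E F f (fun y => D y (Z k y)) B := fun k =>
    (IsVectorFieldOn.mfderiv_isSmoothAlongOn (hZ k) hA₁ hf.contMDiffOn).mono fun y hy => hy.1.1
  have hws : IsSmoothAlongOn E F f (fun y => w (f y)) B :=
    hw.comp_isSmoothAlongOn hf.contMDiffOn fun y hy => hy.2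
  let Gm : M → Matrix (Fin m) (Fin m) ℝ := fun y =>
    Matrix.of fun j k => g.val (f y) (D y (Z j y)) (D y (Z k y))
  let d : M → ℝ := fun y => (Gm y).det
  let q : M → Fin m → ℝ := fun y j => g.val (f y) (D y (Z j y)) (w (f y))
  let c : M → Fin m → ℝ := fun y => (Gm y).cramer (q y)
  let n : (y : M) → TangentSpace 𝓘(ℝ, E) (f y) := fun y =>
    d y • w (f y) + ∑ k, (-c y k) • D y (Z k y)
  let p : M → ℝ := fun y => g.val (f y) (ξ y) (n y)
  let N : (y : M) → TangentSpace 𝓘(ℝ, E) (f y) := fun y =>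
    p y • n y + (-(1 / 2) * g.val (f y) (n y) (n y)) • ξ y
  have hGs : ∀ j k, ContMDiffOn 𝓘(ℝ, F) 𝓘(ℝ, ℝ) ∞ (fun y => Gm y j k) B := fun j k =>
    g.contMDiffOn_val (hZs j) (hZs k)
  have hds : ContMDiffOn 𝓘(ℝ, F) 𝓘(ℝ, ℝ) ∞ d B := contMDiffOn_det hGs
  have hcs : ∀ k, ContMDiffOn 𝓘(ℝ, F) 𝓘(ℝ, ℝ) ∞ (fun y => c y k) B := by
    intro k
    simp only [c, Matrix.cramer_apply]
    refine contMDiffOn_det fun i j => ?_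
    by_cases hjk : j = k
    · subst hjk
      simpa using g.contMDiffOn_val (hZs i) hws
    · simpa [Matrix.updateCol_apply, hjk] using hGs i j
  have hns : IsSmoothAlongOn E F f n B :=
    (hws.smul hds).add (IsSmoothAlongOn.sum _ hf.contMDiffOn fun k _ => (hZs k).smul (hcs k).neg)
  have hps : ContMDiffOn 𝓘(ℝ, F) 𝓘(ℝ, ℝ) ∞ p B := g.contMDiffOn_val hξs hns
  have hNs : IsSmoothAlongOn E F f N B :=
    (hns.smul hps).add (hξs.smul (contMDiffOn_const.mul (g.contMDiffOn_val hns hns)))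
  -- `n` is orthogonal to the screen
  have hnZ : ∀ y j, g.val (f y) (D y (Z j y)) (n y) = 0 := by
    intro y j
    have := congrFun (Matrix.mulVec_cramer (Gm y) (q y)) j
    simp only [Matrix.mulVec, dotProduct, Pi.smul_apply, smul_eq_mul] at this
    simp only [n, map_add, map_sum, map_smul, smul_eq_mul]
    have h2 : ∑ k, -c y k * g.val (f y) (D y (Z j y)) (D y (Z k y)) = -(d y * q y j) := by
      rw [← this, ← Finset.sum_neg_distrib]
      exact Finset.sum_congr rfl fun k _ => by simp [Gm, c]; ring
    rw [h2]
    simp [q]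
  have hξξ : ∀ y ∈ B, g.val (f y) (ξ y) (ξ y) = 0 := fun y hy => hrad y hy.1.2 _
  have hξN : ∀ y ∈ B, g.val (f y) (ξ y) (N y) = p y ^ 2 := by
    intro y hy
    simp only [N, map_add, map_smul, smul_eq_mul, hξξ y hy]
    simp only [p]; ring
  have hNN : ∀ y ∈ B, g.val (f y) (N y) (N y) = 0 := by
    intro y hy
    have hn : g.val (f y) (n y) (ξ y) = p y := g.symm _ _ _
    simp only [N, map_add, map_smul, smul_eq_mul, add_apply, smul_apply, hξξ y hy, hn]
    simp only [← show p y = g.val (f y) (ξ y) (n y) from rfl]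
    ring
  have hNZ : ∀ y ∈ B, ∀ z ∈ S y, g.val (f y) (N y) (D y z) = 0 := by
    intro y hy z hz
    rw [(hZS y hy.1.1).2] at hz
    induction hz using Submodule.span_induction with
    | mem z hz =>
      obtain ⟨j, rfl⟩ := hz
      have h1 : g.val (f y) (D y (Z j y)) (ξ y) = 0 := by
        rw [g.symm]; exact hrad y hy.1.2 _
      dsimp only
      rw [g.symm]
      simp only [N, map_add, map_smul, smul_eq_mul, hnZ y j, h1, mul_zero, add_zero]
    | zero => simp
    | add w w' _ _ h h' => simp [h, h']
    | smul t w _ h => simp [h]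
  -- the pairing with `ξ` is nonzero at the given point
  have hxB : x₀ ∈ B := ⟨⟨hx₁, hx₂⟩, hx₃⟩
  have hd0 : d x₀ ≠ 0 := det_gram_screen_ne_zero hS (hZS x₀ hx₁).1 (hZS x₀ hx₁).2
  have hp : ∀ y ∈ B, p y = d y * g.val (f y) (ξ y) (w (f y)) := by
    intro y hy
    have h1 : ∀ b, g.val (f y) (ξ y) (D y b) = 0 := hrad y hy.1.2
    simp [p, n, h1]
  have hp0 : p x₀ ≠ 0 := by
    rw [hp x₀ hxB, hww₀]
    exact mul_ne_zero hd0 hw₀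
  refine ⟨B ∩ p ⁻¹' {0}ᶜ, N, hps.continuousOn.isOpen_inter_preimage hB isOpen_compl_singleton,
    ⟨hxB, hp0⟩, ⟨hNs.mono Set.inter_subset_left, fun y hy => ?_⟩, Ξ 0 x₀, hrad x₀ hx₂, ?_⟩
  · refine Submodule.subset_span ⟨⟨(p y ^ 2)⁻¹ • ξ y, ?_, ?_⟩, hNN y hy.1, hNZ y hy.1⟩
    · exact Submodule.smul_mem _ _ (hrad y hy.1.1.2)
    · rw [map_smul, smul_apply, hξN y hy.1]
      exact inv_mul_cancel₀ (pow_ne_zero 2 hy.2)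
  · rw [show g.val (f x₀) (D x₀ (Ξ 0 x₀)) (N x₀) = p x₀ ^ 2 from hξN x₀ hxB]
    exact pow_ne_zero 2 hp0

/-- A section over an open set agrees near a given point with a global section. -/
theorem IsTransversalSectionOn.exists_global [FiniteDimensional ℝ F] [T2Space M]
    (hf : ContMDiff 𝓘(ℝ, F) 𝓘(ℝ, E) ∞ f)
    {N : (x : M) → TangentSpace 𝓘(ℝ, E) (f x)} {W : Set M} (hN : IsTransversalSectionOn g f S N W)
    (hW : IsOpen W) {x₀ : M} (hx : x₀ ∈ W) :
    ∃ N₁ : (x : M) → TangentSpace 𝓘(ℝ, E) (f x), IsTransversalSectionOn g f S N₁ Set.univ ∧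
      ∀ᶠ y in 𝓝 x₀, N₁ y = N y := by
  obtain ⟨χ, hχ⟩ := ((SmoothBumpFunction.nhds_basis_tsupport (I := 𝓘(ℝ, F)) x₀).mem_iff).1
    (hW.mem_nhds hx)
  refine ⟨fun y => χ y • N y, ⟨fun y _ => ?_, fun y _ => ?_⟩, ?_⟩
  · by_cases hy : y ∈ tsupport χ
    · have h1 : IsSmoothAlongOn E F f (fun y => χ y • N y) W :=
        IsSmoothAlongOn.smul χ.contMDiff.contMDiffOn hN.1
      exact (ContMDiffOn.contMDiffAt h1 (hW.mem_nhds (hχ.2 hy))).contMDiffWithinAt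
    · have h1 : IsSmoothAlongOn E F f (fun _ => 0) Set.univ :=
        isSmoothAlongOn_zero hf.contMDiffOn
      refine (h1 y trivial).congr_of_eventuallyEq ?_ ?_
      · rw [nhdsWithin_univ]
        filter_upwards [(isClosed_tsupport χ).isOpen_compl.mem_nhds hy] with z hz
        simp [image_eq_zero_of_notMem_tsupport hz]
      · simp [image_eq_zero_of_notMem_tsupport hy]
  · by_cases hy : y ∈ tsupport χ
    · exact Submodule.smul_mem _ _ (hN.2 y (hχ.2 hy))
    · simp [image_eq_zero_of_notMem_tsupport hy]
  · filter_upwards [χ.eventuallyEq_one] with y hy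
    simp [hy]

open VectorField in
/-- `(£_{φN} g)(X, X) = φ (£_N g)(X, X) + 2 X(φ) g(N, X)`. -/
theorem SemiRiemannianMetric.lieDeriv_smul_self [CompleteSpace E] (g : SemiRiemannianMetric E Mb)
    {φ : Mb → ℝ} {N X : (y : Mb) → TangentSpace 𝓘(ℝ, E) y} {p : Mb}
    (hφ : MDifferentiableAt 𝓘(ℝ, E) 𝓘(ℝ, ℝ) φ p)
    (hN : MDifferentiableAt 𝓘(ℝ, E) 𝓘(ℝ, E).tangent
      (fun x => (Bundle.TotalSpace.mk' E x (N x) : TangentBundle 𝓘(ℝ, E) Mb)) p) :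
    g.lieDeriv (fun y => φ y • N y) X X p =
      φ p * g.lieDeriv N X X p + 2 * (dirDeriv φ p (X p) * g.val p (N p) (X p)) := by
  have h1 : mlieBracket 𝓘(ℝ, E) (fun y => φ y • N y) X p =
      -dirDeriv φ p (X p) • N p + φ p • mlieBracket 𝓘(ℝ, E) N X p :=
    mlieBracket_smul_left hφ hN
  have h2 : ∀ ψ : Mb → ℝ, dirDeriv ψ p (φ p • N p) = φ p * dirDeriv ψ p (N p) := fun ψ =>
    map_smul (mfderiv 𝓘(ℝ, E) 𝓘(ℝ, ℝ) ψ p) (φ p) (N p)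
  simp only [SemiRiemannianMetric.lieDeriv, h1, h2]
  simp only [map_add, map_smul, map_neg, add_apply, smul_apply, neg_apply, smul_eq_mul, neg_smul]
  rw [g.symm p (X p) (N p), g.symm p (X p) (mlieBracket 𝓘(ℝ, E) N X p)]
  ring

/-- The null transversal bundle of a null hypersurface is never a Killing distribution: if `N` and
`φ N` both satisfy the Killing equation, then `ξ(φ) g(N, ξ) = 0`. -/
theorem not_isKillingTransversal [CompleteSpace E] [FiniteDimensional ℝ F] [T2Space M] [Nonempty M]
    (h : IsNullHypersurface (F := F) g f m) (hS : IsScreenDistribution g f m S) :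
    ¬ IsKillingTransversal g f S := by
  intro hK
  obtain ⟨x₀⟩ := ‹Nonempty M›
  have hf := h.contMDiff
  obtain ⟨W, N, hW, hxW, hN, a, ha, haN⟩ := exists_isTransversalSectionOn h hS x₀
  have ha0 : a ≠ 0 := by
    rintro rfl
    simp at haN
  obtain ⟨ℓ, hℓ⟩ : ∃ ℓ : F →L[ℝ] ℝ, ℓ a ≠ 0 := SeparatingDual.exists_ne_zero (R := ℝ) ha0
  set e := extChartAt 𝓘(ℝ, F) x₀ with he
  have heo : IsOpen e.source := isOpen_extChartAt_source x₀
  have hex : x₀ ∈ e.source := mem_extChartAt_source x₀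
  let φ : M → ℝ := fun y => ℓ (e y)
  have hes : ContMDiffOn 𝓘(ℝ, F) 𝓘(ℝ, F) ∞ e e.source := by
    rw [he, extChartAt_source]; exact contMDiffOn_extChartAt
  have hφ : ContMDiffOn 𝓘(ℝ, F) 𝓘(ℝ, ℝ) ∞ φ e.source := ℓ.contMDiff.comp_contMDiffOn hes
  have hφN : IsTransversalSectionOn g f S (fun y => φ y • N y) (W ∩ e.source) :=
    ⟨IsSmoothAlongOn.smul (hφ.mono Set.inter_subset_right)
      (ContMDiffOn.mono hN.1 Set.inter_subset_left),
      fun y hy => Submodule.smul_mem _ _ (hN.2 y hy.1)⟩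
  obtain ⟨A, r, hr⟩ := h.exists_isLocalRetraction x₀
  have hrx : r (f x₀) = x₀ := hr.leftInverse.self_of_nhds
  obtain ⟨A₁, N', hA₁, hx₁, hA₁A, hN', hNN'⟩ := hr.exists_extension hW hxW hN.1
  obtain ⟨A₂, X, hA₂, hx₂, hX, hXa⟩ :=
    exists_isVectorFieldOn_eq (f x₀) (mfderiv 𝓘(ℝ, F) 𝓘(ℝ, E) f x₀ a)
  let B : Set Mb := (A₁ ∩ A₂) ∩ (A ∩ r ⁻¹' e.source)
  have hB : IsOpen B :=
    (hA₁.inter hA₂).inter (hr.contMDiffOn.continuousOn.isOpen_inter_preimage hr.isOpen heo)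
  have hxB : f x₀ ∈ B := ⟨⟨hx₁, hx₂⟩, hr.mem, by rw [Set.mem_preimage, hrx]; exact hex⟩
  have hφr : ContMDiffOn 𝓘(ℝ, E) 𝓘(ℝ, ℝ) ∞ (φ ∘ r) B :=
    hφ.comp (hr.contMDiffOn.mono fun z hz => hz.2.1) fun z hz => hz.2.2
  have hN'B : IsVectorFieldOn ∞ N' B := hN'.mono fun z hz => hz.1.1
  have hXB : IsVectorFieldOn ∞ X B := hX.mono fun z hz => hz.1.2
  have hφN'B : IsVectorFieldOn ∞ (fun z => (φ ∘ r) z • N' z) B :=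
    IsSmoothAlongOn.smul (b := id) hφr hN'B
  have hXt : X (f x₀) ∈ tangentImage (F := F) f x₀ := hXa ▸ ⟨a, rfl⟩
  obtain ⟨N₁, hN₁, hN₁N⟩ := hN.exists_global hf hW hxW
  obtain ⟨N₂, hN₂, hN₂N⟩ := hφN.exists_global hf (hW.inter heo) ⟨hxW, hex⟩
  have k1 := hK N₁ hN₁ x₀ B N' X X hB hxB hN'B hXB hXB
    (by filter_upwards [hNN', hN₁N] with y h1 h2; rw [h1, h2]) hXt hXt
  have k2 := hK N₂ hN₂ x₀ B _ X X hB hxB hφN'B hXB hXB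
    (by
      filter_upwards [hNN', hN₂N, hr.leftInverse] with y h1 h2 h3
      simp only [Function.comp_apply]
      rw [h1, h2, h3]) hXt hXt
  have hdφr := (hφr.contMDiffAt (hB.mem_nhds hxB)).mdifferentiableAt (by simp)
  rw [g.lieDeriv_smul_self hdφr
    ((ContMDiffOn.contMDiffAt hN'B (hB.mem_nhds hxB)).mdifferentiableAt (by simp)), k1,
    mul_zero, zero_add, hXa, hNN'.self_of_nhds, g.symm] at k2
  -- the derivative of the extended function in the direction of the normal vector
  have hdr : MDifferentiableAt 𝓘(ℝ, E) 𝓘(ℝ, F) r (f x₀) :=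
    (hr.contMDiffOn.contMDiffAt (hr.isOpen.mem_nhds hr.mem)).mdifferentiableAt (by simp)
  have hde : MDifferentiableAt 𝓘(ℝ, F) 𝓘(ℝ, F) e x₀ :=
    (hes.contMDiffAt (heo.mem_nhds hex)).mdifferentiableAt (by simp)
  have hdφ : MDifferentiableAt 𝓘(ℝ, F) 𝓘(ℝ, ℝ) φ x₀ :=
    (hφ.contMDiffAt (heo.mem_nhds hex)).mdifferentiableAt (by simp)
  have hd : dirDeriv (φ ∘ r) (f x₀) (mfderiv 𝓘(ℝ, F) 𝓘(ℝ, E) f x₀ a) = ℓ a := by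
    have d1 := mvfderiv_comp_apply_vec hrx hdφ hdr (mfderiv 𝓘(ℝ, F) 𝓘(ℝ, E) f x₀ a)
    have d2 := hr.mfderiv_apply_mfderiv (hf.mdifferentiable (by simp) x₀) a
    have d3 := mvfderiv_comp_apply_vec (φ := ℓ) (f := e) (x := x₀) rfl ℓ.mdifferentiableAt hde a
    have d4 : (mfderiv 𝓘(ℝ, F) 𝓘(ℝ, F) e x₀ a : F) = a :=
      congrArg (fun L : F →L[ℝ] F => L a) (mfderiv_extChartAt_self (I := 𝓘(ℝ, F)) (x := x₀))
    have d5 : (mvfderiv 𝓘(ℝ, F) ℓ (e x₀) : F →L[ℝ] ℝ) = ℓ := ℓ.mfderiv_eq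
    have d6 : mvfderiv 𝓘(ℝ, F) φ x₀ a = ℓ a := by
      refine d3.trans ?_
      exact (congrArg (fun L : F →L[ℝ] ℝ => L (mfderiv 𝓘(ℝ, F) 𝓘(ℝ, F) e x₀ a)) d5).trans
        (congrArg ℓ d4)
    refine d1.trans (Eq.trans ?_ d6)
    exact congrArg (fun v : F => (mvfderiv 𝓘(ℝ, F) φ x₀ : F →L[ℝ] ℝ) v) d2
  rw [hd] at k2
  exact mul_ne_zero two_ne_zero (mul_ne_zero hℓ haN) k2

end Sections

/-! ### Normal complex contact metric structures -/

section ContactAlgebra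

variable {E : Type*} [NormedAddCommGroup E] [NormedSpace ℂ E]
  {Mb : Type*} [TopologicalSpace Mb] [ChartedSpace E Mb] [IsManifold 𝓘(ℂ, E) ω Mb]

omit [IsManifold 𝓘(ℂ, E) ω Mb] in
theorem cpxJ_cpxJ (p : Mb) (a : TangentSpace 𝓘(ℝ, E) p) : cpxJ p (cpxJ p a) = -a := by
  have : ∀ b : E, Complex.I • Complex.I • b = -b := fun b => by
    rw [smul_smul, Complex.I_mul_I, neg_one_smul]
  exact this a

namespace ComplexAlmostContactMetricStructure

variable (Q : ComplexAlmostContactMetricStructure E Mb) {i : Q.ι} {p : Mb}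

theorem g_cpxJ (a b : TangentSpace 𝓘(ℝ, E) p) :
    Q.g.val p (cpxJ p a) b = -Q.g.val p a (cpxJ p b) := by
  have := Q.hermitian p a (cpxJ p b)
  rw [cpxJ_cpxJ, map_neg] at this
  linarith

theorem v_U (hp : p ∈ Q.dom i) : Q.u i p (cpxJ p (Q.U i p)) = 0 := by
  have h := Q.g_cpxJ (Q.U i p) (Q.U i p)
  rw [Q.g.symm p (cpxJ p _), Q.g_U i p hp] at h
  linarith

theorem u_G (hp : p ∈ Q.dom i) (a : TangentSpace 𝓘(ℝ, E) p) : Q.u i p (Q.G i p a) = 0 := by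
  have h := Q.G_skew i p hp (Q.U i p) a
  rw [Q.G_U i p hp, Q.g_U i p hp] at h
  simpa using h

theorem v_G (hp : p ∈ Q.dom i) (a : TangentSpace 𝓘(ℝ, E) p) :
    Q.u i p (cpxJ p (Q.G i p a)) = 0 := by
  have h := Q.G_J i p hp a
  rw [← neg_eq_iff_eq_neg.2 h, map_neg, Q.u_G hp, neg_zero]

theorem H_U (hp : p ∈ Q.dom i) : Q.G i p (cpxJ p (Q.U i p)) = 0 := by
  rw [Q.G_J i p hp, Q.G_U i p hp, map_zero, neg_zero]

theorem G_G_of_horizontal (hp : p ∈ Q.dom i) {ξ : TangentSpace 𝓘(ℝ, E) p}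
    (hu : Q.u i p ξ = 0) (hv : Q.u i p (cpxJ p ξ) = 0) : Q.G i p (Q.G i p ξ) = -ξ := by
  rw [Q.G_sq i p hp, hu, hv, zero_smul, zero_smul, add_zero, add_zero]

/-- `G` is an isometry on horizontal vectors. -/
theorem g_G_G (hp : p ∈ Q.dom i) {ξ : TangentSpace 𝓘(ℝ, E) p}
    (hu : Q.u i p ξ = 0) (hv : Q.u i p (cpxJ p ξ) = 0) (a : TangentSpace 𝓘(ℝ, E) p) :
    Q.g.val p (Q.G i p ξ) (Q.G i p a) = Q.g.val p ξ a := by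
  rw [Q.g.symm, Q.G_skew i p hp, Q.G_G_of_horizontal hp hu hv, map_neg, neg_neg, Q.g.symm]

/-- `H = GJ` is skew-symmetric. -/
theorem g_H (hp : p ∈ Q.dom i) (a b : TangentSpace 𝓘(ℝ, E) p) :
    Q.g.val p a (Q.G i p (cpxJ p b)) = -Q.g.val p (Q.G i p (cpxJ p a)) b := by
  rw [Q.G_J i p hp, Q.G_J i p hp, map_neg, map_neg, neg_apply, neg_neg, Q.g_cpxJ, Q.G_skew i p hp,
    Q.G_J i p hp, map_neg, neg_neg]

theorem isVectorFieldOn_G {A : Set Mb} (hA : A ⊆ Q.dom i)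
    {X : (y : Mb) → TangentSpace 𝓘(ℝ, E) y} (hX : IsVectorFieldOn ∞ X A) :
    IsVectorFieldOn ∞ (fun y => Q.G i y (X y)) A :=
  ContMDiffOn.clm_bundle_apply ((Q.smooth_G i).mono hA) hX

end ComplexAlmostContactMetricStructure

namespace ComplexContactMetricStructure

variable {n : ℕ} (Q : ComplexContactMetricStructure n E Mb) {i : Q.ι} {A : Set Mb} {p : Mb}

open VectorField

variable {Q} in
/-- For a normal structure, `S(U, N) = 0` says that `G [U, N] - [U, GN] + σ(U) HN` is vertical. -/
theorem IsNormal.g_G_mlieBracket (hQ : Q.IsNormal) (hA : IsOpen A) (hAi : A ⊆ Q.dom i)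
    (hp : p ∈ A) {N : (y : Mb) → TangentSpace 𝓘(ℝ, E) y} (hN : IsVectorFieldOn ∞ N A)
    {ξ : TangentSpace 𝓘(ℝ, E) p} (hu : Q.u i p ξ = 0) (hv : Q.u i p (cpxJ p ξ) = 0)
    (hH : Q.g.val p ξ (Q.G i p (cpxJ p (N p))) = 0) :
    Q.g.val p (Q.G i p ξ) (mlieBracket 𝓘(ℝ, E) (Q.U i) N p) =
      -Q.g.val p ξ (mlieBracket 𝓘(ℝ, E) (Q.U i) (fun y => Q.G i y (N y)) p) := by
  have hpi := hAi hp
  have hS := ((hQ i A hA hAi).2 N hN p hp).1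
  have hGU : (fun y => Q.G i y (Q.U i y)) =ᶠ[𝓝 p]
      (0 : (y : Mb) → TangentSpace 𝓘(ℝ, E) y) := by
    filter_upwards [hA.mem_nhds hp] with y hy using Q.G_U i y (hAi hy)
  have hb : ∀ Y : (y : Mb) → TangentSpace 𝓘(ℝ, E) y,
      mlieBracket 𝓘(ℝ, E) (fun y => Q.G i y (Q.U i y)) Y p = 0 := fun Y => by
    rw [hGU.mlieBracket_vectorField_eq (Filter.EventuallyEq.refl _ Y)]
    exact congrFun mlieBracket_zero_left p
  have h1 : ∀ a, Q.g.val p (Q.U i p) (Q.G i p a) = 0 := fun a => by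
    rw [Q.g_U i p hpi, Q.u_G hpi]
  set a := mlieBracket 𝓘(ℝ, E) (Q.U i) N p with ha
  set b := mlieBracket 𝓘(ℝ, E) (Q.U i) (fun y => Q.G i y (N y)) p with hb'
  have h2 := congrArg (fun c => Q.g.val p (Q.G i p ξ) c) hS
  simp only [tensorS, nijenhuis, hb, ← ha, ← hb', ComplexAlmostContactMetricStructure.H,
    ComplexAlmostContactMetricStructure.v, ContinuousLinearMap.comp_apply, h1, Q.H_U hpi,
    Q.v_U hpi, Q.G_U i p hpi, map_zero, mul_zero, zero_smul, smul_zero, sub_zero, add_zero,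
    map_add, map_sub, map_smul, Q.g_G_G hpi hu hv, hH] at h2
  rw [Q.G_skew i p hpi]
  linarith

/-- Evaluation of `£_N g` on a pair `(X, U)` through the formula for `du`. -/
theorem lieDeriv_U (hA : IsOpen A) (hAi : A ⊆ Q.dom i) (hp : p ∈ A)
    {N X : (y : Mb) → TangentSpace 𝓘(ℝ, E) y} (hN : IsVectorFieldOn ∞ N A)
    (hX : IsVectorFieldOn ∞ X A) :
    Q.g.lieDeriv N X (Q.U i) p = 2 * Q.g.val p (N p) (Q.G i p (X p))
      + 2 * wedge (Q.σ i) (Q.v i) p (N p) (X p)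
      + dirDeriv (fun y => Q.u i y (N y)) p (X p)
      + Q.g.val p (X p) (mlieBracket 𝓘(ℝ, E) (Q.U i) N p) := by
  have hdu := Q.du_eq i A N X hA hAi hN hX p hp
  have h1 : (fun y => Q.g.val y (X y) (Q.U i y)) =ᶠ[𝓝 p] fun y => Q.u i y (X y) := by
    filter_upwards [hA.mem_nhds hp] with y hy
    rw [Q.g.symm, Q.g_U i y (hAi hy)]
  have h2 : dirDeriv (fun y => Q.g.val y (X y) (Q.U i y)) p (N p) =
      dirDeriv (fun y => Q.u i y (X y)) p (N p) := by
    unfold dirDeriv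
    rw [h1.mfderiv_eq]
    rfl
  have h3 : mlieBracket 𝓘(ℝ, E) N (Q.U i) p = -mlieBracket 𝓘(ℝ, E) (Q.U i) N p :=
    mlieBracket_swap_apply
  rw [SemiRiemannianMetric.lieDeriv, h2, h3, Q.g.symm p _ (Q.U i p), Q.g_U i p (hAi hp), map_neg]
  unfold extDer at hdu
  linarith

end ComplexContactMetricStructure

end ContactAlgebra

/-! ### Killing sections of the null transversal bundle -/

section Killing

variable {E : Type*} [NormedAddCommGroup E] [NormedSpace ℂ E]
  {Mb : Type*} [TopologicalSpace Mb] [ChartedSpace E Mb] [IsManifold 𝓘(ℂ, E) ω Mb]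
  {F : Type*} [NormedAddCommGroup F] [NormedSpace ℝ F]
  {M : Type*} [TopologicalSpace M] [ChartedSpace F M] [IsManifold 𝓘(ℝ, F) ∞ M]
  {n m : ℕ} {f : M → Mb} {S : (x : M) → Submodule ℝ (TangentSpace 𝓘(ℝ, F) x)}

/-- With an adapted screen, a section of the null transversal bundle that is Killing at a point
vanishes at that point: evaluated on `(Gξ, U)`, the Killing equation reads
`g(Gξ, [U, N]) = 2 g(N, ξ)`, while normality gives `g(Gξ, [U, N]) = -g(ξ, [U, GN])`, which is zero
because `U` and `GN` are tangent to the hypersurface. -/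
theorem IsTransversalSectionOn.eq_zero_of_isKillingAlongAt [FiniteDimensional ℂ E]
    {Q : ComplexContactMetricStructure n E Mb} (hQ : Q.IsNormal)
    (h : IsNullHypersurface (F := F) Q.g f m)
    (htan : IsTangentToVertical F Q.toComplexAlmostContactMetricStructure f)
    (hS : IsScreenDistribution Q.g f m S)
    (hadapted : IsAdaptedScreen Q.toComplexAlmostContactMetricStructure f S)
    {W : Set M} (hW : IsOpen W) {N : (x : M) → TangentSpace 𝓘(ℝ, E) (f x)}
    (hN : IsTransversalSectionOn Q.g f S N W) {x : M} (hx : x ∈ W)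
    (hK : IsKillingAlongAt (F := F) Q.g f N x) : N x = 0 := by
  have : CompleteSpace E := FiniteDimensional.complete ℂ E
  have : FiniteDimensional ℝ E := FiniteDimensional.complexToReal E
  have hf := h.contMDiff
  obtain ⟨i, hi⟩ := Q.cover (f x)
  refine eq_zero_of_mem_transversalSpace h hS (hN.2 x hx) fun ξ hξ => ?_
  -- the section is orthogonal to the images of the normal line and to the vertical vectors
  have hort : ∀ y ∈ W, ∀ b ∈ (S y).map (mfderiv 𝓘(ℝ, F) 𝓘(ℝ, E) f y).toLinearMap,
      Q.g.val (f y) (N y) b = 0 := by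
    rintro y hy _ ⟨Z, hZ, rfl⟩
    exact apply_eq_zero_of_mem_transversalSpace (hN.2 y hy) hZ
  have hvert : ∀ y, f y ∈ Q.dom i → ∀ η ∈ normalSpace F Q.g f y,
      Q.u i (f y) η = 0 ∧ Q.u i (f y) (cpxJ (f y) η) = 0 := by
    intro y hy η hη
    obtain ⟨⟨a, ha⟩, b, hb⟩ := htan i y hy
    have h1 : Q.g.val (f y) η (Q.U i (f y)) = 0 := ha ▸ hη a
    have h2 : Q.g.val (f y) η (-cpxJ (f y) (Q.U i (f y))) = 0 :=
      (show _ = -cpxJ (f y) (Q.U i (f y)) from hb) ▸ hη b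
    rw [Q.g.symm, Q.g_U i _ hy] at h1
    rw [map_neg, Q.g.symm, Q.g_cpxJ, neg_neg, Q.g_U i _ hy] at h2
    exact ⟨h1, h2⟩
  obtain ⟨hu, hv⟩ := hvert x hi ξ hξ
  obtain ⟨A, r, hr⟩ := h.exists_isLocalRetraction x
  obtain ⟨A₁, N', hA₁, hx₁, -, hN', hNN'⟩ := hr.exists_extension hW hx hN.1
  obtain ⟨A₂, X, hA₂, hx₂, hX, hXξ⟩ := exists_isVectorFieldOn_eq (f x) (Q.G i (f x) ξ)
  let B : Set Mb := (A₁ ∩ A₂) ∩ Q.dom i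
  have hB : IsOpen B := (hA₁.inter hA₂).inter (Q.isOpen_dom i)
  have hxB : f x ∈ B := ⟨⟨hx₁, hx₂⟩, hi⟩
  have hBi : B ⊆ Q.dom i := Set.inter_subset_right
  have hN'B : IsVectorFieldOn ∞ N' B := hN'.mono fun z hz => hz.1.1
  have hXB : IsVectorFieldOn ∞ X B := hX.mono fun z hz => hz.1.2
  have hUB : IsVectorFieldOn ∞ (Q.U i) B := (Q.smooth_U i).mono hBi
  have hGN'B : IsVectorFieldOn ∞ (fun y => Q.G i y (N' y)) B := Q.isVectorFieldOn_G hBi hN'B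
  have hnear : ∀ᶠ y in 𝓝 x, y ∈ W ∧ f y ∈ B ∧ N' (f y) = N y := by
    filter_upwards [hW.mem_nhds hx, hf.continuous.continuousAt.preimage_mem_nhds
      (hB.mem_nhds hxB), hNN'] with y h1 h2 h3 using ⟨h1, h2, h3⟩
  have hNx : N' (f x) = N x := hNN'.self_of_nhds
  -- `G N` is tangent to the hypersurface
  have hGN : ∀ᶠ y in 𝓝 x, Q.G i (f y) (N' (f y)) ∈ tangentImage (F := F) f y := by
    filter_upwards [hnear] with y ⟨hyW, hyB, hy⟩
    refine h.mem_tangentImage_of_orthogonal y fun η hη => ?_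
    have := hort y hyW _ ((hadapted i y (hBi hyB)).1 η hη).2.1
    rw [hy, Q.g.symm, Q.G_skew i _ (hBi hyB), this, neg_zero]
  have hUt : ∀ᶠ y in 𝓝 x, Q.U i (f y) ∈ tangentImage (F := F) f y := by
    filter_upwards [hnear] with y hy using (htan i y (hBi hy.2.1)).1
  have hbr : Q.g.val (f x) ξ (VectorField.mlieBracket 𝓘(ℝ, E) (Q.U i)
      (fun y => Q.G i y (N' y)) (f x)) = 0 := by
    obtain ⟨w, hw⟩ := hr.mlieBracket_mem_tangentImage hf hB hxB hUB hGN'B hUt hGN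
    rw [← hw]
    exact hξ w
  have hGξ := hadapted i x hi |>.1 ξ hξ
  have hHN : Q.g.val (f x) ξ (Q.G i (f x) (cpxJ (f x) (N' (f x)))) = 0 := by
    rw [Q.g_H hi, hNx, Q.g.symm]
    exact neg_eq_zero.2 (hort x hx _ hGξ.2.2)
  have hnorm := hQ.g_G_mlieBracket hB hBi hxB hN'B hu hv hHN
  rw [hbr, neg_zero] at hnorm
  -- the vertical components of the section vanish along the hypersurface
  have huN : ∀ᶠ y in 𝓝 x, Q.u i (f y) (N' (f y)) = 0 := by
    filter_upwards [hnear] with y ⟨hyW, hyB, hy⟩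
    rw [hy, ← Q.g_U i _ (hBi hyB), Q.g.symm]
    exact hort y hyW _ (hadapted i y (hBi hyB)).2.1
  have hvN : Q.v i (f x) (N' (f x)) = 0 := by
    have := hort x hx _ (hadapted i x hi).2.2
    rw [ComplexAlmostContactMetricStructure.V, map_neg, Q.g.symm, Q.g_cpxJ, neg_neg,
      Q.g_U i _ hi] at this
    rw [hNx]
    exact this
  have hXt : X (f x) ∈ tangentImage (F := F) f x := by
    obtain ⟨Z, -, hZ⟩ := hGξ.2.1
    rw [hXξ]
    exact ⟨Z, hZ⟩
  have hdu : dirDeriv (fun y => Q.u i y (N' y)) (f x) (X (f x)) = 0 := by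
    refine mvfderiv_eq_zero_of_comp_eventuallyEq_zero (φ := fun y => Q.u i y (N' y)) ?_
      (hf.mdifferentiable (by simp) x) huN hXt
    have hsm : ContMDiffOn 𝓘(ℝ, E) 𝓘(ℝ, ℝ) ∞ (fun y => Q.u i y (N' y)) B :=
      (Q.g.contMDiffOn_val (b := id) hUB hN'B).congr fun y hy => (Q.g_U i y (hBi hy) _).symm
    exact (hsm.contMDiffAt (hB.mem_nhds hxB)).mdifferentiableAt (by simp)
  have hkill := hK B N' X (Q.U i) hB hxB hN'B hXB hUB hNN' hXt (htan i x hi).1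
  rw [Q.lieDeriv_U hB hBi hxB hN'B hXB, hdu, hXξ, hnorm, Q.G_G_of_horizontal hi hu hv, wedge, hvN,
    show Q.v i (f x) (Q.G i (f x) ξ) = 0 from Q.v_G hi ξ, map_neg, hNx, Q.g.symm] at hkill
  linarith

end Killing

theorem mainTheorem4 (n q : ℕ) (hq : 0 < q) (hqn : q < n)
    {E : Type*} [NormedAddCommGroup E] [NormedSpace ℂ E] [FiniteDimensional ℂ E]
    (hE : Module.finrank ℂ E = 2 * n + 1)
    {Mb : Type*} [TopologicalSpace Mb] [T2Space Mb] [ChartedSpace E Mb] [IsManifold 𝓘(ℂ, E) ω Mb]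
    {F : Type*} [NormedAddCommGroup F] [NormedSpace ℝ F] [FiniteDimensional ℝ F]
    {M : Type*} [TopologicalSpace M] [T2Space M] [Nonempty M] [ChartedSpace F M]
    [IsManifold 𝓘(ℝ, F) ∞ M]
    (Q : ComplexContactMetricStructure n E Mb) (hindex : Q.g.HasIndex (4 * q))
    (hnormal : Q.IsNormal)
    (f : M → Mb) (hnull : IsNullHypersurface (F := F) Q.g f (4 * n))
    (htan : IsTangentToVertical F Q.toComplexAlmostContactMetricStructure f)
    (S : (x : M) → Submodule ℝ (TangentSpace 𝓘(ℝ, F) x))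
    (hS : IsScreenDistribution Q.g f (4 * n) S) :
    ¬ IsKillingTransversal Q.g f S ∧
    (IsAdaptedScreen Q.toComplexAlmostContactMetricStructure f S →
      ∀ W : Set M, IsOpen W → W.Nonempty →
        ∀ N : (x : M) → TangentSpace 𝓘(ℝ, E) (f x), IsTransversalSectionOn Q.g f S N W →
          (∀ x ∈ W, N x ≠ 0) →
          ¬ ∀ x ∈ W, IsKillingAlongAt (F := F) Q.g f N x) := by
  have : CompleteSpace E := FiniteDimensional.complete ℂ E
  refine ⟨not_isKillingTransversal hnull hS, ?_⟩
  rintro hadapted W hW ⟨x, hx⟩ N hN hN0 hK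
  exact hN0 x hx
    (hN.eq_zero_of_isKillingAlongAt hnormal hnull htan hS hadapted hW hx (hK x hx))
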